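/- Let $\alpha$ be an indeterminate and let $\Lambda$ be the ring of symmetric functions in infinitely many variables with coefficients in $\mathbb{Q}(\alpha)$, so $\Lambda=\mathbb{Q}(\alpha)[p_1,p_2,\dots]$ with $p_k$ the $k$-th power sum. For a partition $\mu$ with $m_k$ parts equal to $k$ and $\ell(\mu)$ parts in total, put $p_\mu=\prod_i p_{\mu_i}$ and $z_\mu=\prod_k k^{m_k}m_k!$, and let $\langle\,,\rangle$ be the bilinear form on $\Lambda$ with $\langle p_\mu,p_\nu\rangle=\delta_{\mu\nu}\,z_\mu\,\alpha^{\ell(\mu)}$. Let $m_\mu$ be the symmetric monomials and $\le$ the dominance ordering on partitions of the same integer. There is a unique family $(J_\mu)$ of elements of $\Lambda$, indexed by all partitions $\mu$ (the Jack symmetric functions), such that (i) $\langle J_\mu,J_\nu\rangle=0$ if $\mu\neq\nu$; (ii) $J_\nu=\sum_{\mu\le\nu}v_{\nu\mu}(\alpha)\,m_\mu$ with $v_{\nu\mu}(\alpha)\in\mathbb{Q}(\alpha)$; (iii) $v_{\nu,1^N}=N!$ if $|\nu|=N$. Let $J_\mu(x_1,\dots,x_n;\alpha)$ be the symmetric polynomial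 obtained from $J_\mu$ by restriction to $n$ variables. On $\mathbb{Q}(\alpha)[x_1,\dots,x_n]$ consider the Dunkl operators $$D_i=\alpha x_i\frac{\partial}{\partial x_i}+\sum_{j\ne i}\frac{x_i}{x_i-x_j}(1-K_{ij}),\qquad i=1,\dots,n,$$ where $K_{ij}$ exchanges $x_i$ and $x_j$, and the creation operators $$B_i^+=\sum_{J\subset\{1,\dots,n\},\ |J|=i}x_J\,D_J,\qquad x_J=\prod_{j\in J}x_j,\qquad D_J=(D_{j_1}+1)(D_{j_2}+2)\cdots(D_{j_i}+i)\ \text{ for } J=\{j_1<j_2<\dots<j_i\}.$$ Then for every $n\ge 0$ and all integers $\lambda_1\ge\lambda_2\ge\dots\ge\lambda_n\ge 0$, with $\lambda=(\lambda_1,\dots,\lambda_n)$, $$J_\lambda(x_1,\dots,x_n;\alpha)=(B_n^+)^{\lambda_n}(B_{n-1}^+)^{\lambda_{n-1}-\lambda_n}\cdots(B_1^+)^{\lambda_1-\lambda_2}\cdot 1 .$$ -/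

import Mathlib

noncomputable section

namespace JackRodrigues

/-! Symmetric functions in infinitely many variables and their restriction to `n` variables -/

/-- The ring `Λ ⊗ K` of symmetric functions in infinitely many variables (`K` of characteristic
zero), presented as the polynomial ring in the power sums: the variable `X k` is `p_k`, `k ≥ 1`. -/
abbrev SymFun (K : Type*) [Field K] : Type _ := MvPolynomial ℕ+ K

/-- The symmetric polynomial `f(x_1, …, x_n)`, that is, `p_k ↦ x_1 ^ k + ⋯ + x_n ^ k`. -/
def toVars {K : Type*} [Field K] (n : ℕ) : SymFun K →ₐ[K] MvPolynomial (Fin n) K :=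
  MvPolynomial.aeval fun k : ℕ+ => MvPolynomial.psum (Fin n) K (k : ℕ)

/-- `z_μ = ∏_k k ^ m_k * m_k !`, for the partition `μ` with `m k` parts equal to `k`. -/
def zed (m : ℕ+ →₀ ℕ) : ℕ :=
  m.prod fun k mk => (k : ℕ) ^ mk * mk.factorial

/-- The bilinear scalar product with `⟨p_μ, p_ν⟩ = δ_{μν} z_μ α ^ ℓ(μ)`. The coefficient of `f` at
the exponent vector `m` is the coefficient of `p_μ`, where `μ` has `m k` parts equal to `k`; the
number of parts is `ℓ(μ) = m.degree`. -/
def scalarProduct {K : Type*} [Field K] (α : K) (f g : SymFun K) : K :=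
  ∑ m ∈ f.support, f.coeff m * g.coeff m * ((zed m : K) * α ^ m.degree)

/-- `μ ≤ ν` in the dominance ordering of partitions of `N`. -/
def DominatedBy {N : ℕ} (μ ν : N.Partition) : Prop :=
  ∀ i : ℕ, ((μ.parts.sort (· ≥ ·)).take i).sum ≤ ((ν.parts.sort (· ≥ ·)).take i).sum

/-- The partition `1 ^ N`. -/
def onesPartition (N : ℕ) : N.Partition :=
  Nat.Partition.ofSums N (Multiset.replicate N 1) (by simp)

/-- The conditions that specify the Jack functions `J_μ`, `μ` running over all partitions:
orthogonality, triangularity in the symmetric monomials with respect to the dominance ordering, and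
the normalization `v_{μ, 1 ^ N} = N!`. An identity in `Λ` is expressed as the identity of the
symmetric polynomials in `n` variables for all `n`. -/
structure IsJackFamily {K : Type*} [Field K] (α : K)
    (Jack : (N : ℕ) → N.Partition → SymFun K) : Prop where
  orthogonal : ∀ (M N : ℕ) (μ : M.Partition) (ν : N.Partition),
    (⟨M, μ⟩ : (k : ℕ) × k.Partition) ≠ ⟨N, ν⟩ → scalarProduct α (Jack M μ) (Jack N ν) = 0
  triangular : ∀ (N : ℕ) (ν : N.Partition), ∃ v : N.Partition → K,
    (∀ μ, ¬ DominatedBy μ ν → v μ = 0) ∧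
    (∀ n : ℕ, toVars n (Jack N ν) =
      ∑ μ : N.Partition, v μ • MvPolynomial.msymm (Fin n) K μ) ∧
    v (onesPartition N) = (N.factorial : K)

/-! Dunkl operators and creation operators -/

/-- The operator `K_{ij}` exchanging the variables `x_i` and `x_j`. -/
def exchange {K : Type*} [Field K] {n : ℕ} (i j : Fin n) :
    MvPolynomial (Fin n) K →ₐ[K] MvPolynomial (Fin n) K :=
  MvPolynomial.rename (Equiv.swap i j)

theorem sub_dvd_sub_exchange {K : Type*} [Field K] {n : ℕ} (i j : Fin n)
    (f : MvPolynomial (Fin n) K) :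
    (MvPolynomial.X i - MvPolynomial.X j : MvPolynomial (Fin n) K) ∣ f - exchange i j f := by
  rw [← Ideal.mem_span_singleton, ← Ideal.Quotient.mk_eq_mk_iff_sub_mem]
  set I : Ideal (MvPolynomial (Fin n) K) :=
    Ideal.span {(MvPolynomial.X i - MvPolynomial.X j : MvPolynomial (Fin n) K)} with hI
  have hij : Ideal.Quotient.mk I (MvPolynomial.X i) = Ideal.Quotient.mk I (MvPolynomial.X j) := by
    rw [Ideal.Quotient.mk_eq_mk_iff_sub_mem]
    exact Ideal.mem_span_singleton_self _
  have h : Ideal.Quotient.mkₐ K I = (Ideal.Quotient.mkₐ K I).comp (exchange i j) := by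
    apply MvPolynomial.algHom_ext
    intro k
    simp only [AlgHom.comp_apply, exchange, MvPolynomial.rename_X, Ideal.Quotient.mkₐ_eq_mk]
    rcases eq_or_ne k i with rfl | hki
    · rw [Equiv.swap_apply_left]
      exact hij
    · rcases eq_or_ne k j with rfl | hkj
      · rw [Equiv.swap_apply_right]
        exact hij.symm
      · rw [Equiv.swap_apply_of_ne_of_ne hki hkj]
  exact DFunLike.congr_fun h f

theorem X_sub_X_ne_zero {K : Type*} [Field K] {n : ℕ} {i j : Fin n} (h : i ≠ j) :
    (MvPolynomial.X i - MvPolynomial.X j : MvPolynomial (Fin n) K) ≠ 0 :=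
  sub_ne_zero.mpr fun e => h (MvPolynomial.X_injective e)

/-- For `i ≠ j`, the operator `f ↦ (f - K_{ij} f) / (x_i - x_j)`; the quotient is a polynomial. -/
def dividedDifference {K : Type*} [Field K] {n : ℕ} (i j : Fin n) (h : i ≠ j) :
    Module.End K (MvPolynomial (Fin n) K) where
  toFun f := (sub_dvd_sub_exchange i j f).choose
  map_add' f g := by
    apply mul_left_cancel₀ (X_sub_X_ne_zero (K := K) h)
    rw [mul_add, ← (sub_dvd_sub_exchange i j (f + g)).choose_spec,
      ← (sub_dvd_sub_exchange i j f).choose_spec, ← (sub_dvd_sub_exchange i j g).choose_spec,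
      map_add]
    ring
  map_smul' c f := by
    apply mul_left_cancel₀ (X_sub_X_ne_zero (K := K) h)
    rw [RingHom.id_apply, mul_smul_comm, ← (sub_dvd_sub_exchange i j (c • f)).choose_spec,
      ← (sub_dvd_sub_exchange i j f).choose_spec, map_smul, smul_sub]

/-- Multiplication by a polynomial, as an operator. -/
def mulBy {K : Type*} [Field K] {n : ℕ} (f : MvPolynomial (Fin n) K) :
    Module.End K (MvPolynomial (Fin n) K) :=
  LinearMap.mulLeft K f

/-- The Dunkl operator
`D_i = α x_i ∂/∂x_i + ∑_{j ≠ i} x_i / (x_i - x_j) (1 - K_{ij})`. -/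
def dunkl {K : Type*} [Field K] (α : K) {n : ℕ} (i : Fin n) :
    Module.End K (MvPolynomial (Fin n) K) :=
  α • (mulBy (MvPolynomial.X i) * (MvPolynomial.pderiv i).toLinearMap) +
    ∑ j : Fin n, if h : i ≠ j then mulBy (MvPolynomial.X i) * dividedDifference i j h else 0

/-- `D_J = (D_{j_1} + 1) (D_{j_2} + 2) ⋯ (D_{j_ℓ} + ℓ)` for `J = {j_1 < j_2 < ⋯ < j_ℓ}`. -/
def dunklProd {K : Type*} [Field K] (α : K) {n : ℕ} (J : Finset (Fin n)) :
    Module.End K (MvPolynomial (Fin n) K) :=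
  (List.ofFn fun k : Fin J.card =>
    dunkl α (J.orderEmbOfFin rfl k) + (((k : ℕ) + 1 : ℕ) : Module.End K _)).prod

/-- The creation operator `B_i^+ = ∑_{|J| = i} x_J D_J`, where `x_J = ∏_{j ∈ J} x_j`. -/
def creation {K : Type*} [Field K] (α : K) (n i : ℕ) :
    Module.End K (MvPolynomial (Fin n) K) :=
  ∑ J ∈ Finset.powersetCard i (Finset.univ : Finset (Fin n)),
    mulBy (∏ j ∈ J, MvPolynomial.X j) * dunklProd α J

/-- The part `lam_i`, `1 ≤ i ≤ n`, of `lam = (lam_1, …, lam_n)`, and `0` for other `i`. -/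
def part {n : ℕ} (lam : Fin n → ℕ) (i : ℕ) : ℕ :=
  if h : 1 ≤ i ∧ i ≤ n then lam ⟨i - 1, by omega⟩ else 0

/-- `(B_n^+)^{lam_n} (B_{n-1}^+)^{lam_{n-1} - lam_n} ⋯ (B_1^+)^{lam_1 - lam_2} · 1`. -/
def rodrigues {K : Type*} [Field K] (α : K) {n : ℕ} (lam : Fin n → ℕ) :
    MvPolynomial (Fin n) K :=
  (List.ofFn fun k : Fin n =>
    creation α n (n - k) ^ (part lam (n - k) - part lam (n - k + 1))).prod 1

/-- The partition whose nonzero parts are the nonzero entries of `lam = (lam_1, …, lam_n)`. -/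
def toPartition {n : ℕ} (lam : Fin n → ℕ) : (∑ i, lam i).Partition :=
  Nat.Partition.ofSums _ (Finset.univ.val.map lam) rfl

end JackRodrigues

end

/-! The kernel `Π = ∑_m (norm α m)⁻¹ p_m(x) p_m(y)` reproduces the scalar product: contracting it
with a linear functional `ψ` on polynomials in `y_1, …, y_i` gives a symmetric function (`dualFun`)
whose product with a homogeneous `g` of the same degree is `ψ (g(y_1, …, y_i))`.

Everything rests on one adjointness, `creation_kernelTerm`. Write `D_a = x_a T_a`, with `T_a` the
rational Dunkl operator. Then `B_i^+` acting on the `n` variables `x` of `Π` agrees with `T_1 ⋯ T_i`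
acting on exactly `i` variables `y`. Indeed `α ∂_a log Π = ∑_k y_k / (1 - x_a y_k)`, and the divided
differences of the factors `1 / (1 - x_b y_k)` already produced cancel the terms of this sum whose
`y_k` has been used. Both sides thus become the sum over injections `τ : {1, …, i} → {1, …, n}` of
`∏_k x_{τ k} / (1 - x_{τ k} y_k)`, times `Π`. The shifts `1, …, i` in `D_J` cancel the constants in
`x y / (1 - x y) = 1 / (1 - x y) - 1`. A formal variable `t` records the degree.

Hence the Rodrigues product is the restriction to `n` variables of a symmetric function `jackFun`
not depending on `n`, and it is dual to an explicit functional built from products `T_1 ⋯ T_k`.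
Orthogonality follows from two dominance bounds, without eigenoperators. The `D_a` do not raise
dominance and `x_J` adds at most one column, so the monomials of `J_μ` are `≤ μ`
(`dominated_of_coeff_jackFun`). Each `T_1 ⋯ T_k` removes a column, so the functional of `J_λ` kills
`x^a` unless `λ ≤ a` (`dominated_of_jackFunctional`). If `⟨J_λ, J_μ⟩ ≠ 0`, then `λ ≤ a ≤ μ` for some
`a`; by symmetry also `μ ≤ λ`. The normalization is a count of subsets
(`coeff_indicatorExp_creation`).

Uniqueness is linear algebra (`IsTriangular.unique`): positivity for rational `α > 0` leaves no
isotropic vectors over `ℚ(α)`, and a triangular orthogonal family with a prescribed nonzero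
coordinate is then determined. -/

noncomputable section

namespace JackRodrigues

open MvPolynomial

/-! Dominance of exponents and the rational Dunkl operators -/

/-- Every partial sum of values of `a` is bounded by a partial sum of at most as many values
of `b`. -/
def Dominated {σ τ : Type*} (a : σ → ℕ) (b : τ → ℕ) : Prop :=
  ∀ S : Finset σ, ∃ T : Finset τ, T.card ≤ S.card ∧ ∑ s ∈ S, a s ≤ ∑ t ∈ T, b t

theorem Dominated.trans {σ τ ρ : Type*} {a : σ → ℕ} {b : τ → ℕ} {c : ρ → ℕ}
    (hab : Dominated a b) (hbc : Dominated b c) : Dominated a c := by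
  intro S
  obtain ⟨T, hT, h⟩ := hab S
  obtain ⟨U, hU, h'⟩ := hbc T
  exact ⟨U, hU.trans hT, h.trans h'⟩

theorem dominated_of_le {σ : Type*} {a b : σ → ℕ} (h : ∀ s, a s ≤ b s) : Dominated a b :=
  fun S => ⟨S, le_rfl, Finset.sum_le_sum fun s _ => h s⟩

/-- A partial sum containing both or neither of `i`, `j` is compared on the same set. If it contains
just one of them, that index is exchanged for whichever of the two has the larger value of `b`. -/
theorem dominated_of_pair {σ : Type*} [DecidableEq σ] {a b : σ → ℕ} {i j : σ} (hij : i ≠ j)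
    (h : ∀ k, k ≠ i → k ≠ j → a k = b k) (hsum : a i + a j ≤ b i + b j)
    (hi : a i ≤ max (b i) (b j)) (hj : a j ≤ max (b i) (b j)) : Dominated a b := by
  have one (S : Finset σ) (p q : σ) (hp : p ∈ S) (hq : q ∉ S)
      (h : ∀ k, k ≠ p → k ≠ q → a k = b k) (hle : a p ≤ max (b p) (b q)) :
      ∃ T : Finset σ, T.card ≤ S.card ∧ ∑ s ∈ S, a s ≤ ∑ t ∈ T, b t := by
    have hrest : ∑ s ∈ S.erase p, a s = ∑ s ∈ S.erase p, b s := by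
      refine Finset.sum_congr rfl fun k hk => h k (Finset.ne_of_mem_erase hk) ?_
      rintro rfl
      exact hq (Finset.mem_of_mem_erase hk)
    rcases le_total (b p) (b q) with hb | hb
    · refine ⟨insert q (S.erase p), ?_, ?_⟩
      · rw [Finset.card_insert_of_notMem (fun hm => hq (Finset.mem_of_mem_erase hm)),
          Finset.card_erase_add_one hp]
      · rw [Finset.sum_insert (fun hm => hq (Finset.mem_of_mem_erase hm)),
          ← Finset.add_sum_erase S a hp, hrest]
        gcongr
        exact hle.trans (max_eq_right hb).le
    · refine ⟨S, le_rfl, ?_⟩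
      rw [← Finset.add_sum_erase S a hp, ← Finset.add_sum_erase S b hp, hrest]
      gcongr
      exact hle.trans (max_eq_left hb).le
  intro S
  by_cases hiS : i ∈ S
  · by_cases hjS : j ∈ S
    · refine ⟨S, le_rfl, ?_⟩
      have hj' : j ∈ S.erase i := Finset.mem_erase.2 ⟨hij.symm, hjS⟩
      have hrest : ∑ s ∈ (S.erase i).erase j, a s = ∑ s ∈ (S.erase i).erase j, b s := by
        refine Finset.sum_congr rfl fun k hk => ?_
        simp only [Finset.mem_erase] at hk
        exact h k hk.2.1 hk.1
      rw [← Finset.add_sum_erase S a hiS, ← Finset.add_sum_erase S b hiS,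
        ← Finset.add_sum_erase _ a hj', ← Finset.add_sum_erase _ b hj', hrest]
      omega
    · exact one S i j hiS hjS h hi
  · by_cases hjS : j ∈ S
    · exact one S j i hjS hiS (fun k h1 h2 => h k h2 h1) (by rwa [max_comm])
    · refine ⟨S, le_rfl, (Finset.sum_congr rfl fun k hk => h k ?_ ?_).le⟩
      · rintro rfl; exact hiS hk
      · rintro rfl; exact hjS hk

/-- The indicator function of a set of indices. -/
def indicator {σ : Type*} [DecidableEq σ] (J : Finset σ) (k : σ) : ℕ := if k ∈ J then 1 else 0

theorem sum_indicator {σ : Type*} [DecidableEq σ] (S J : Finset σ) :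
    ∑ s ∈ S, indicator J s = (S ∩ J).card := by
  simp [indicator, Finset.sum_ite_mem]

section Operators

variable {K : Type*} [Field K] {n : ℕ}

theorem X_sub_X_mul_dividedDifference (i j : Fin n) (h : i ≠ j) (f : MvPolynomial (Fin n) K) :
    (X i - X j) * dividedDifference i j h f = f - exchange i j f :=
  (sub_dvd_sub_exchange i j f).choose_spec.symm

theorem dividedDifference_eq {i j : Fin n} (h : i ≠ j) {f g : MvPolynomial (Fin n) K}
    (hg : (X i - X j) * g = f - exchange i j f) : dividedDifference i j h f = g :=
  mul_left_cancel₀ (X_sub_X_ne_zero (K := K) h)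
    ((X_sub_X_mul_dividedDifference i j h f).trans hg.symm)

/-- The Dunkl operator `T_i = α ∂/∂x_i + ∑_{j ≠ i} 1 / (x_i - x_j) (1 - K_{ij})`. -/
def rationalDunkl (α : K) (i : Fin n) : Module.End K (MvPolynomial (Fin n) K) :=
  α • (pderiv i).toLinearMap + ∑ j : Fin n, if h : i ≠ j then dividedDifference i j h else 0

theorem dunkl_eq (α : K) (i : Fin n) : dunkl α i = mulBy (X i) * rationalDunkl α i := by
  rw [dunkl, rationalDunkl, mul_add, mul_smul_comm, Finset.mul_sum]
  congr 1
  refine Finset.sum_congr rfl fun j _ => ?_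
  split_ifs <;> simp

/-- The exponent `c₀ + p e_i + q e_j`. -/
def pairExp (c₀ : Fin n →₀ ℕ) (i j : Fin n) (p q : ℕ) : Fin n →₀ ℕ :=
  c₀ + Finsupp.single i p + Finsupp.single j q

theorem exchange_pairExp {c₀ : Fin n →₀ ℕ} {i j : Fin n} (hi : c₀ i = 0)
    (hj : c₀ j = 0) (p q : ℕ) :
    exchange i j (monomial (pairExp c₀ i j p q) (1 : K)) = monomial (pairExp c₀ i j q p) 1 := by
  have hc : Finsupp.mapDomain (Equiv.swap i j) c₀ = c₀ := by
    ext k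
    rw [← Finsupp.equivMapDomain_eq_mapDomain, Finsupp.equivMapDomain_apply, Equiv.symm_swap]
    rcases eq_or_ne k i with rfl | hki
    · rw [Equiv.swap_apply_left, hi, hj]
    · rcases eq_or_ne k j with rfl | hkj
      · rw [Equiv.swap_apply_right, hi, hj]
      · rw [Equiv.swap_apply_of_ne_of_ne hki hkj]
  rw [exchange, rename_monomial]
  simp only [pairExp, Finsupp.mapDomain_add, Finsupp.mapDomain_single, hc,
    Equiv.swap_apply_left, Equiv.swap_apply_right]
  rw [add_right_comm]

theorem monomial_pairExp (c₀ : Fin n →₀ ℕ) (i j : Fin n) (p q : ℕ) :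
    monomial (pairExp c₀ i j p q) (1 : K) = monomial c₀ 1 * X i ^ p * X j ^ q := by
  simp [pairExp, X_pow_eq_monomial, monomial_mul]

/-- This is the geometric sum for `(x^d - y^d) / (x - y)`, times the common factor `x^{c₀} (x_i
x_j)^q`. -/
theorem dividedDifference_pairExp {c₀ : Fin n →₀ ℕ} {i j : Fin n} (h : i ≠ j) (hi : c₀ i = 0)
    (hj : c₀ j = 0) (q d : ℕ) :
    dividedDifference i j h (monomial (pairExp c₀ i j (q + d) q) (1 : K)) =
      ∑ s ∈ Finset.range d, monomial (pairExp c₀ i j (q + s) (q + (d - 1 - s))) 1 := by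
  apply dividedDifference_eq
  rw [exchange_pairExp hi hj]
  simp only [monomial_pairExp, pow_add]
  have := (Commute.all (X i : MvPolynomial (Fin n) K) (X j)).geom_sum₂_mul d
  trans monomial c₀ 1 * X i ^ q * X j ^ q *
    ((∑ s ∈ Finset.range d, X i ^ s * X j ^ (d - 1 - s)) * (X i - X j))
  · rw [Finset.sum_mul, Finset.mul_sum, Finset.mul_sum]
    exact Finset.sum_congr rfl fun s _ => by ring
  · rw [this]
    ring

theorem dividedDifference_pairExp_swap {c₀ : Fin n →₀ ℕ} {i j : Fin n} (h : i ≠ j)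
    (hi : c₀ i = 0) (hj : c₀ j = 0) (p q : ℕ) :
    dividedDifference i j h (monomial (pairExp c₀ i j p q) (1 : K)) =
      -dividedDifference i j h (monomial (pairExp c₀ i j q p) (1 : K)) := by
  apply dividedDifference_eq
  rw [mul_neg, X_sub_X_mul_dividedDifference, exchange_pairExp hi hj, exchange_pairExp hi hj,
    neg_sub]

theorem exists_pairExp {i j : Fin n} (h : i ≠ j) (c : Fin n →₀ ℕ) :
    ∃ c₀ : Fin n →₀ ℕ, c₀ i = 0 ∧ c₀ j = 0 ∧ c = pairExp c₀ i j (c i) (c j) := by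
  refine ⟨(c.erase i).erase j, ?_, Finsupp.erase_same, ?_⟩
  · rw [Finsupp.erase_ne h, Finsupp.erase_same]
  · ext k
    simp only [pairExp, Finsupp.add_apply]
    rcases eq_or_ne k i with rfl | hki
    · simp [Finsupp.erase_ne h, h.symm]
    · rcases eq_or_ne k j with rfl | hkj
      · simp [hki]
      · simp [Finsupp.erase_ne hki, Finsupp.erase_ne hkj, hki, hkj]

/-- The exponents that occur in `(x^c - K_{ij} x^c) / (x_i - x_j)`. -/
theorem coeff_dividedDifference_monomial {i j : Fin n} (h : i ≠ j) {c c' : Fin n →₀ ℕ}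
    (hc : coeff c' (dividedDifference i j h (monomial c (1 : K))) ≠ 0) :
    (∀ k, k ≠ i → k ≠ j → c' k = c k) ∧ c' i + c' j + 1 = c i + c j ∧
      c' i < max (c i) (c j) ∧ c' j < max (c i) (c j) := by
  obtain ⟨c₀, hi, hj, hc₀⟩ := exists_pairExp h c
  have key (q d : ℕ)
      (hc : coeff c' (dividedDifference i j h (monomial (pairExp c₀ i j (q + d) q) (1 : K))) ≠ 0) :
      (∀ k, k ≠ i → k ≠ j → c' k = c₀ k) ∧ c' i + c' j + 1 = q + d + q ∧ c' i < q + d ∧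
        c' j < q + d := by
    rw [dividedDifference_pairExp h hi hj, coeff_sum] at hc
    obtain ⟨s, hs, hne⟩ := Finset.exists_ne_zero_of_sum_ne_zero hc
    rw [coeff_monomial] at hne
    have he : pairExp c₀ i j (q + s) (q + (d - 1 - s)) = c' := by
      by_contra hne'
      simp [hne'] at hne
    have hs' := Finset.mem_range.1 hs
    have h1 : c' i = q + s := by
      simp [← he, pairExp, hi, h.symm]
    have h2 : c' j = q + (d - 1 - s) := by
      simp [← he, pairExp, hj, h]
    refine ⟨fun k hki hkj => ?_, by omega, by omega, by omega⟩
    simp [← he, pairExp, hki.symm, hkj.symm]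
  have hrest : ∀ k, k ≠ i → k ≠ j → c k = c₀ k := fun k hki hkj => by
    conv_lhs => rw [hc₀]
    simp [pairExp, hki.symm, hkj.symm]
  rcases le_total (c j) (c i) with hle | hle
  · rw [hc₀, ← Nat.add_sub_cancel' hle] at hc
    obtain ⟨h1, h2, h3, h4⟩ := key _ _ hc
    refine ⟨fun k hki hkj => (h1 k hki hkj).trans (hrest k hki hkj).symm, ?_, ?_, ?_⟩ <;> omega
  · rw [hc₀, dividedDifference_pairExp_swap h hi hj, ← Nat.add_sub_cancel' hle, coeff_neg,
      neg_ne_zero] at hc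
    obtain ⟨h1, h2, h3, h4⟩ := key _ _ hc
    refine ⟨fun k hki hkj => (h1 k hki hkj).trans (hrest k hki hkj).symm, ?_, ?_, ?_⟩ <;> omega

theorem coeff_ne_zero_of_linearMap {L : Module.End K (MvPolynomial (Fin n) K)}
    {f : MvPolynomial (Fin n) K} {c' : Fin n →₀ ℕ} (h : coeff c' (L f) ≠ 0) :
    ∃ c, coeff c f ≠ 0 ∧ coeff c' (L (monomial c 1)) ≠ 0 := by
  have : L f = ∑ c ∈ f.support, coeff c f • L (monomial c 1) := by
    conv_lhs => rw [f.as_sum, map_sum]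
    refine Finset.sum_congr rfl fun c _ => ?_
    rw [← map_smul, smul_monomial, smul_eq_mul, mul_one]
  rw [this, coeff_sum] at h
  obtain ⟨c, hc, hne⟩ := Finset.exists_ne_zero_of_sum_ne_zero h
  rw [coeff_smul] at hne
  exact ⟨c, mem_support_iff.1 hc, right_ne_zero_of_mul hne⟩

/-- `T_a` costs one unit of degree, and that unit may be put back at `a`. The derivative takes it
from `a`. A divided difference replaces `(c_a, c_b)` by a pair of total one less with both entries
strictly below the maximum, which leaves room for the unit at `a` and for one already put back at
`b`. The set `J` carries the units restored for the operators applied before. -/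
theorem dominated_of_coeff_rationalDunkl_monomial (α : K) {a : Fin n} {J : Finset (Fin n)}
    (ha : a ∉ J) {c c' : Fin n →₀ ℕ}
    (hc : coeff c' (rationalDunkl α a (monomial c (1 : K))) ≠ 0) :
    Dominated (⇑c' + indicator (insert a J)) (⇑c + indicator J) := by
  rw [rationalDunkl, LinearMap.add_apply, coeff_add] at hc
  by_cases h1 : coeff c' ((α • (pderiv a).toLinearMap) (monomial c (1 : K))) = 0
  · rw [h1, zero_add, LinearMap.sum_apply, coeff_sum] at hc
    obtain ⟨b, -, hb⟩ := Finset.exists_ne_zero_of_sum_ne_zero hc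
    split_ifs at hb with hab
    · obtain ⟨hk, hs, hl, hr⟩ := coeff_dividedDifference_monomial hab hb
      have hbJ : indicator (insert a J) b = indicator J b := by
        simp [indicator, Ne.symm hab]
      have haJ : indicator (insert a J) a = 1 := by simp [indicator]
      have haJ' : indicator J a = 0 := by simp [indicator, ha]
      have hb1 : indicator J b ≤ 1 := by unfold indicator; split_ifs <;> simp
      refine dominated_of_pair hab ?_ ?_ ?_ ?_
      · intro k hka hkb
        simp [indicator, hka, hk k hka hkb]
      all_goals
        simp only [Pi.add_apply, hbJ, haJ, haJ']
        omega
    · simp at hb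
  · apply dominated_of_le
    have hd : c' = c - Finsupp.single a 1 ∧ c a ≠ 0 := by
      rw [LinearMap.smul_apply, Derivation.coeFn_coe, pderiv_monomial, one_mul, coeff_smul,
        coeff_monomial] at h1
      constructor
      · by_contra hne
        simp [Ne.symm hne] at h1
      · rintro h0
        simp [h0] at h1
    intro k
    rcases eq_or_ne k a with rfl | hk
    · have := hd.2
      simp [hd.1, indicator, ha]
      omega
    · simp [hd.1, indicator, hk]

/-- The product `E_{j_1} ⋯ E_{j_k}` of operators. -/
def opProd {R : Type*} [Monoid R] {σ : Type*} (E : ℕ → σ → R) {k : ℕ} (j : Fin k → σ) : R :=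
  (List.ofFn fun s : Fin k => E s (j s)).prod

theorem opProd_zero {R : Type*} [Monoid R] {σ : Type*} (E : ℕ → σ → R) (j : Fin 0 → σ) :
    opProd E j = 1 := by
  simp [opProd]

theorem opProd_succ {R : Type*} [Monoid R] {σ : Type*} (E : ℕ → σ → R) {k : ℕ}
    (j : Fin (k + 1) → σ) :
    opProd E j = E 0 (j 0) * opProd (fun s => E (s + 1)) (fun s => j s.succ) := by
  simp [opProd, List.ofFn_succ]

theorem dominated_of_coeff_opProd_rationalDunkl (α : K) {k : ℕ} (j : Fin k → Fin n)
    (hj : Function.Injective j) {f : MvPolynomial (Fin n) K} {c' : Fin n →₀ ℕ}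
    (hc : coeff c' (opProd (fun _ => rationalDunkl α) j f) ≠ 0) :
    ∃ c, coeff c f ≠ 0 ∧ Dominated (⇑c' + indicator (Finset.univ.image j)) (⇑c) := by
  induction k generalizing c' with
  | zero =>
    rw [opProd_zero] at hc
    exact ⟨c', hc, dominated_of_le fun s => by simp [indicator]⟩
  | succ k ih =>
    rw [opProd_succ, Module.End.mul_apply] at hc
    obtain ⟨d, hd, hd'⟩ := coeff_ne_zero_of_linearMap hc
    obtain ⟨c, hc, hdom⟩ := ih (fun s => j s.succ) (hj.comp (Fin.succ_injective k)) hd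
    refine ⟨c, hc, Dominated.trans ?_ hdom⟩
    have himg : Finset.univ.image j =
        insert (j 0) (Finset.univ.image fun s : Fin k => j s.succ) := by
      ext x
      simp [Fin.exists_fin_succ, eq_comm]
    rw [himg]
    refine dominated_of_coeff_rationalDunkl_monomial α ?_ hd'
    simp only [Finset.mem_image, Finset.mem_univ, true_and, not_exists]
    intro s hs
    exact Fin.succ_ne_zero s (hj hs)

theorem dominated_of_coeff_dunkl (α : K) (a : Fin n) {f : MvPolynomial (Fin n) K}
    {c' : Fin n →₀ ℕ} (hc : coeff c' (dunkl α a f) ≠ 0) :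
    ∃ c, coeff c f ≠ 0 ∧ Dominated (⇑c') (⇑c) := by
  rw [dunkl_eq, Module.End.mul_apply, mulBy, LinearMap.mulLeft_apply, coeff_X_mul'] at hc
  split_ifs at hc with ha
  · obtain ⟨c, hc, hc'⟩ := coeff_ne_zero_of_linearMap hc
    refine ⟨c, hc, ?_⟩
    have := dominated_of_coeff_rationalDunkl_monomial α (Finset.notMem_empty a) hc'
    convert this using 1
    · ext k
      have ha' : c' a ≠ 0 := by simpa using ha
      rcases eq_or_ne k a with rfl | hk
      · simp [indicator]; omega
      · simp [indicator, hk]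
    · ext k
      simp [indicator]
  · simp at hc

/-- The operator `D_a + s`. -/
def shiftedDunkl (α : K) (s : ℕ) (a : Fin n) : Module.End K (MvPolynomial (Fin n) K) :=
  dunkl α a + (s : Module.End K (MvPolynomial (Fin n) K))

theorem dunklProd_eq (α : K) (J : Finset (Fin n)) :
    dunklProd α J = opProd (fun s => shiftedDunkl α (s + 1)) (J.orderEmbOfFin rfl) :=
  rfl

theorem natCast_end_apply (k : ℕ) (f : MvPolynomial (Fin n) K) :
    (k : Module.End K (MvPolynomial (Fin n) K)) f = (k : K) • f := by
  rw [Module.End.natCast_apply, Nat.cast_smul_eq_nsmul]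

theorem dominated_of_coeff_opProd_dunkl (α : K) {k : ℕ} (j : Fin k → Fin n) (u : ℕ → ℕ)
    {f : MvPolynomial (Fin n) K} {c' : Fin n →₀ ℕ}
    (hc : coeff c' (opProd (fun s => shiftedDunkl α (u s)) j f) ≠ 0) :
    ∃ c, coeff c f ≠ 0 ∧ Dominated (⇑c') (⇑c) := by
  induction k generalizing u c' with
  | zero =>
    rw [opProd_zero] at hc
    exact ⟨c', hc, dominated_of_le fun s => le_rfl⟩
  | succ k ih =>
    rw [opProd_succ, Module.End.mul_apply, shiftedDunkl, LinearMap.add_apply, coeff_add] at hc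
    have : ∃ d, coeff d (opProd (fun s => shiftedDunkl α (u (s + 1)))
        (fun s => j s.succ) f) ≠ 0 ∧ Dominated (⇑c') (⇑d) := by
      by_cases h1 : coeff c' (dunkl α (j 0)
          (opProd (fun s => shiftedDunkl α (u (s + 1)))
            (fun s => j s.succ) f)) = 0
      · rw [h1, zero_add, natCast_end_apply, coeff_smul] at hc
        exact ⟨c', right_ne_zero_of_mul hc, dominated_of_le fun s => le_rfl⟩
      · exact dominated_of_coeff_dunkl α _ h1
    obtain ⟨d, hd, hdom⟩ := this
    obtain ⟨c, hc, hdom'⟩ := ih _ (fun s => u (s + 1)) hd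
    exact ⟨c, hc, hdom.trans hdom'⟩

theorem coeff_dunkl_eq_zero (α : K) {a : Fin n} (f : MvPolynomial (Fin n) K) {c : Fin n →₀ ℕ}
    (hc : c a = 0) : coeff c (dunkl α a f) = 0 := by
  rw [dunkl_eq, Module.End.mul_apply, mulBy, LinearMap.mulLeft_apply, coeff_X_mul',
    if_neg (by simpa using hc)]

/-- `D_a f` is divisible by `x_a`, so at an exponent vanishing at all the indices only the scalar
shifts contribute. -/
theorem coeff_opProd_dunkl (α : K) {k : ℕ} (j : Fin k → Fin n) (u : ℕ → ℕ)
    (f : MvPolynomial (Fin n) K) {c : Fin n →₀ ℕ} (hc : ∀ s, c (j s) = 0) :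
    coeff c (opProd (fun s => shiftedDunkl α (u s)) j f) =
      ((∏ s ∈ Finset.range k, u s : ℕ) : K) * coeff c f := by
  induction k generalizing u with
  | zero => simp [opProd_zero]
  | succ k ih =>
    rw [opProd_succ, Module.End.mul_apply, shiftedDunkl, LinearMap.add_apply, coeff_add,
      coeff_dunkl_eq_zero α _ (hc 0), zero_add, natCast_end_apply, coeff_smul,
      ih (fun s => j s.succ) (fun s => u (s + 1)) fun s => hc s.succ, Finset.prod_range_succ']
    push_cast
    simp only [smul_eq_mul]
    ring

end Operators

end JackRodrigues

end

noncomputable section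

namespace JackRodrigues

/-! The action of Dunkl operators on a reproducing kernel -/

/-- The sum over injections `τ : Fin k → Y` of `∏_s g (j s) (τ s)`. -/
def matchSum {R X Y : Type*} [CommRing R] [Fintype Y] [DecidableEq Y] (g : X → Y → R) {k : ℕ}
    (j : Fin k → X) : R :=
  ∑ τ : Fin k → Y, if Function.Injective τ then ∏ s, g (j s) (τ s) else 0

theorem matchSum_zero {R X Y : Type*} [CommRing R] [Fintype Y] [DecidableEq Y] (g : X → Y → R)
    (j : Fin 0 → X) : matchSum g j = 1 := by
  rw [matchSum, Fintype.sum_unique, if_pos (Function.injective_of_subsingleton _)]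
  simp

/-- Removing the value `τ 0` first gives the recursion matched below by one more Dunkl operator: the
new index pairs with any `y` not yet used. -/
theorem matchSum_succ {R X Y : Type*} [CommRing R] [Fintype Y] [DecidableEq Y] (g : X → Y → R)
    {k : ℕ} (j : Fin (k + 1) → X) :
    matchSum g j = ∑ τ : Fin k → Y, if Function.Injective τ then
      (∑ y, if y ∈ Set.range τ then 0 else g (j 0) y) * ∏ s, g (j s.succ) (τ s) else 0 := by
  rw [matchSum, ← (Fin.consEquiv fun _ => Y).sum_comp, Fintype.sum_prod_type_right]
  refine Finset.sum_congr rfl fun τ _ => ?_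
  have hinj : ∀ y, Function.Injective (Fin.consEquiv (fun _ : Fin (k + 1) => Y) (y, τ)) ↔
      y ∉ Set.range τ ∧ Function.Injective τ := fun y => Fin.cons_injective_iff
  by_cases hτ : Function.Injective τ
  · rw [if_pos hτ, Finset.sum_mul]
    refine Finset.sum_congr rfl fun y _ => ?_
    by_cases hy : y ∈ Set.range τ
    · rw [if_neg fun h => ((hinj y).1 h).1 hy, if_pos hy, zero_mul]
    · rw [if_pos ((hinj y).2 ⟨hy, hτ⟩), if_neg hy, Fin.prod_univ_succ]
      simp
  · rw [if_neg hτ]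
    exact Finset.sum_eq_zero fun y _ => if_neg fun h => hτ ((hinj y).1 h).2

theorem sum_injective_eq_sum_perm {R : Type*} [CommRing R] {i : ℕ} (F : (Fin i → Fin i) → R) :
    (∑ τ : Fin i → Fin i, if Function.Injective τ then F τ else 0) =
      ∑ σ : Equiv.Perm (Fin i), F σ := by
  rw [← Finset.sum_filter]
  symm
  refine Finset.sum_bij (fun σ _ => ⇑σ) ?_ ?_ ?_ ?_
  · intro σ _
    simpa using σ.injective
  · intro σ _ σ' _ h
    exact DFunLike.coe_injective h
  · intro τ hτ
    have hτ' : Function.Injective τ := by simpa using hτ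
    exact ⟨Equiv.ofBijective τ (Finite.injective_iff_bijective.1 hτ'), Finset.mem_univ _, rfl⟩
  · intro σ _
    rfl

theorem sum_notMem_range {R Y : Type*} [CommRing R] [Fintype Y] [DecidableEq Y] {k : ℕ}
    {τ : Fin k → Y} (hτ : Function.Injective τ) (g : Y → R) :
    (∑ y, if y ∈ Set.range τ then 0 else g y) = ∑ y, g y - ∑ s, g (τ s) := by
  have : ∑ s, g (τ s) = ∑ y, if y ∈ Set.range τ then g y else 0 := by
    rw [← Finset.sum_filter, ← Finset.sum_image (f := g) (s := Finset.univ) (g := τ) hτ.injOn]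
    congr 1
    ext y
    simp
  rw [this, eq_sub_iff_add_eq, ← Finset.sum_add_distrib]
  refine Finset.sum_congr rfl fun y _ => ?_
  split_ifs <;> simp

/-- A sum over all injections `τ : Fin i → X`, arranged according to the image of `τ`. -/
theorem sum_injective_eq_sum_powersetCard {R : Type*} [CommRing R] {n i : ℕ}
    (h : Fin n → Fin i → R) :
    (∑ τ : Fin i → Fin n, if Function.Injective τ then ∏ k, h (τ k) k else 0) =
      ∑ J ∈ (Finset.powersetCard i (Finset.univ : Finset (Fin n))).attach,
        matchSum h (J.1.orderEmbOfFin (Finset.mem_powersetCard.1 J.2).2) := by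
  classical
  simp only [matchSum, ← Finset.sum_filter]
  rw [← Finset.sum_fiberwise_of_maps_to (s := Finset.univ.filter fun τ : Fin i → Fin n =>
    Function.Injective τ) (t := Finset.powersetCard i (Finset.univ : Finset (Fin n)))
    (g := fun τ => Finset.univ.image τ), ← Finset.sum_attach]
  · refine Finset.sum_congr rfl fun J _ => ?_
    have hJ := (Finset.mem_powersetCard.1 J.2).2
    have hmem : ∀ τ : Fin i → Fin n, Finset.univ.image τ = J.1 →
        ∀ k, τ k ∈ Set.range (J.1.orderEmbOfFin hJ) := fun τ hτ k => by
      rw [Finset.range_orderEmbOfFin, ← hτ]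
      simp
    have hperm := sum_injective_eq_sum_perm fun π => ∏ s, h (J.1.orderEmbOfFin hJ s) (π s)
    rw [← Finset.sum_filter] at hperm
    -- The two sides index a matching of `J` with `Fin i` in opposite directions, so each
    -- permutation is replaced by its inverse.
    have hsymm : ∀ σ : Equiv.Perm (Fin i), ∏ s, h (J.1.orderEmbOfFin hJ s) (σ s) =
        ∏ k, h (J.1.orderEmbOfFin hJ (σ⁻¹ k)) k := fun σ => by
      rw [← Equiv.prod_comp σ fun k => h (J.1.orderEmbOfFin hJ (σ⁻¹ k)) k]
      simp
    rw [hperm, Finset.sum_congr rfl fun σ _ => hsymm σ,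
      show (∑ σ : Equiv.Perm (Fin i), ∏ k, h (J.1.orderEmbOfFin hJ (σ⁻¹ k)) k) =
          ∑ σ : Equiv.Perm (Fin i), ∏ k, h (J.1.orderEmbOfFin hJ (σ k)) k from
        Equiv.sum_comp (Equiv.inv (Equiv.Perm (Fin i))) fun σ : Equiv.Perm (Fin i) =>
          ∏ k, h (J.1.orderEmbOfFin hJ (σ k)) k]
    symm
    refine Finset.sum_bij (fun σ _ => fun k => J.1.orderEmbOfFin hJ (σ k)) ?_ ?_ ?_ ?_
    · intro σ _
      simp only [Finset.mem_filter, Finset.mem_univ, true_and]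
      refine ⟨(J.1.orderEmbOfFin hJ).injective.comp σ.injective, ?_⟩
      ext x
      have hx : x ∈ J.1 ↔ x ∈ Set.range (J.1.orderEmbOfFin hJ) := by
        rw [Finset.range_orderEmbOfFin, Finset.mem_coe]
      simp only [hx, Finset.mem_image, Finset.mem_univ, true_and, Set.mem_range]
      exact σ.exists_congr_left.trans (by simp)
    · intro σ _ σ' _ h
      ext k
      exact congrArg Fin.val ((J.1.orderEmbOfFin hJ).injective (congrFun h k))
    · intro τ hτ
      simp only [Finset.mem_filter, Finset.mem_univ, true_and] at hτ
      choose π hπ using hmem τ hτ.2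
      have hinj : Function.Injective π := fun k k' hk => hτ.1 (by rw [← hπ, ← hπ, hk])
      exact ⟨Equiv.ofBijective π (Finite.injective_iff_bijective.1 hinj), Finset.mem_univ _,
        funext hπ⟩
    · intro σ _
      rfl
  · intro τ hτ
    simp only [Finset.mem_filter, Finset.mem_univ, true_and] at hτ
    simp [Finset.mem_powersetCard, Finset.card_image_of_injective _ hτ]

/-- A commutative ring with the operators that make up Dunkl operators, and a kernel `Π` whose
logarithmic derivatives are `∑_y v_y / (1 - x_a v_y)`. -/
structure KernelSystem (K R X Y : Type*) [Field K] [CommRing R] [Algebra K R] [Fintype Y] where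
  x : X → R
  v : Y → R
  f : X → Y → R
  kernel : R
  der : X → Derivation K R R
  ex : X → X → R →ₐ[K] R
  dd : X → X → Module.End K R
  sub_mul_dd : ∀ a b, a ≠ b → ∀ F, (x a - x b) * dd a b F = F - ex a b F
  -- This replaces the assumption that `R` is a domain: quotients by `x a - x b` are unique.
  cancel : ∀ a b, a ≠ b → ∀ F, (x a - x b) * F = 0 → F = 0
  f_eq : ∀ a y, f a y = 1 + x a * v y * f a y
  ex_f : ∀ a b y, ex a b (f b y) = f a y
  ex_f_of_ne : ∀ a b c y, c ≠ a → c ≠ b → ex a b (f c y) = f c y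
  ex_v : ∀ a b y, ex a b (v y) = v y
  ex_kernel : ∀ a b, ex a b kernel = kernel
  der_f : ∀ a b y, b ≠ a → der a (f b y) = 0
  der_v : ∀ a y, der a (v y) = 0
  -- The parameter `α` is absorbed in `der`, which in the application is `α ∂_a`.
  der_kernel : ∀ a, der a kernel = (∑ y, v y * f a y) * kernel

namespace KernelSystem

variable {K R X Y : Type*} [Field K] [CommRing R] [Algebra K R] [Fintype Y]
  (S : KernelSystem K R X Y)

theorem dd_eq {a b : X} (h : a ≠ b) {F G : R} (hG : (S.x a - S.x b) * G = F - S.ex a b F) :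
    S.dd a b F = G := by
  refine sub_eq_zero.1 (S.cancel a b h _ ?_)
  rw [mul_sub, S.sub_mul_dd a b h, hG, sub_self]

theorem dd_mul {a b : X} (h : a ≠ b) (F : R) {G : R} (hG : S.ex a b G = G) :
    S.dd a b (F * G) = S.dd a b F * G := by
  apply S.dd_eq h
  rw [← mul_assoc, S.sub_mul_dd a b h, map_mul, hG, sub_mul]

variable [Fintype X] [DecidableEq X]

/-- The operator `∂_a + ∑_{b ≠ a} 1 / (x_a - x_b) (1 - K_{ab})`. -/
def dunklOp (a : X) : Module.End K R :=
  (S.der a).toLinearMap + ∑ b, if a ≠ b then S.dd a b else 0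

theorem dunklOp_apply (a : X) (F : R) :
    S.dunklOp a F = S.der a F + ∑ b, if a ≠ b then S.dd a b F else 0 := by
  rw [dunklOp, LinearMap.add_apply, LinearMap.sum_apply]
  congr 1
  refine Finset.sum_congr rfl fun b _ => ?_
  split_ifs <;> rfl

/-- Divided differences are linear over the functions fixed by the exchanges, so only the derivative
sees the factor `G`. -/
theorem dunklOp_mul (a : X) (F : R) {G : R} (hG : ∀ b, a ≠ b → S.ex a b G = G) :
    S.dunklOp a (F * G) = S.dunklOp a F * G + F * S.der a G := by
  have : ∀ b, (if a ≠ b then S.dd a b (F * G) else 0) = (if a ≠ b then S.dd a b F else 0) * G := by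
    intro b
    split_ifs with h
    · exact S.dd_mul h F (hG b h)
    · rw [zero_mul]
  simp only [dunklOp_apply, Derivation.leibniz, smul_eq_mul, this, ← Finset.sum_mul]
  ring

/-- Only the exchanges of `a` with some `j s` contribute, and each changes a single factor, as `j`
is injective and avoids `a`. The derivative vanishes since no factor involves `x a`. -/
theorem dunklOp_prod {a : X} {k : ℕ} {j : Fin k → X} (hj : Function.Injective j)
    (ha : a ∉ Set.range j) (τ : Fin k → Y) :
    S.dunklOp a (∏ s, S.f (j s) (τ s)) =
      -(∑ s, S.v (τ s) * S.f a (τ s)) * ∏ s, S.f (j s) (τ s) := by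
  have hne : ∀ s, j s ≠ a := fun s hs => ha ⟨s, hs⟩
  have hder : S.der a (∏ s, S.f (j s) (τ s)) = 0 := by
    refine Finset.prod_induction _ (fun r => S.der a r = 0) ?_ ?_ ?_
    · intro p q hp hq
      rw [Derivation.leibniz, hp, hq, smul_zero, smul_zero, add_zero]
    · exact Derivation.map_one_eq_zero _
    · exact fun s _ => S.der_f a _ _ (hne s)
  have hdd : ∀ b, (if a ≠ b then S.dd a b (∏ s, S.f (j s) (τ s)) else 0) =
      ∑ s, if j s = b then -(S.v (τ s) * S.f a (τ s)) * ∏ s, S.f (j s) (τ s) else 0 := by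
    intro b
    by_cases hb : b ∈ Set.range j
    · obtain ⟨s, rfl⟩ := hb
      rw [if_pos (hne s).symm, Finset.sum_eq_single s (fun s' _ hs' => if_neg fun h => hs' (hj h))
        (fun h => absurd (Finset.mem_univ s) h), if_pos rfl]
      apply S.dd_eq (hne s).symm
      rw [← Finset.mul_prod_erase Finset.univ _ (Finset.mem_univ s), map_mul, S.ex_f, map_prod]
      have : ∏ s' ∈ Finset.univ.erase s, S.ex a (j s) (S.f (j s') (τ s')) =
          ∏ s' ∈ Finset.univ.erase s, S.f (j s') (τ s') :=
        Finset.prod_congr rfl fun s' hs' =>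
          S.ex_f_of_ne _ _ _ _ (hne s') fun h => Finset.ne_of_mem_erase hs' (hj h)
      rw [this]
      have h1 := S.f_eq a (τ s)
      have h2 := S.f_eq (j s) (τ s)
      -- With `f = 1 / (1 - x v)` this reads `f_b - f_a = (x_b - x_a) v f_a f_b`.
      have h3 : S.f (j s) (τ s) - S.f a (τ s) = (S.x a - S.x (j s)) *
          (-(S.v (τ s) * S.f a (τ s)) * S.f (j s) (τ s)) := by
        linear_combination S.f a (τ s) * h2 - S.f (j s) (τ s) * h1
      linear_combination -(∏ s' ∈ Finset.univ.erase s, S.f (j s') (τ s')) * h3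
    · rw [Finset.sum_eq_zero fun s _ => if_neg fun h => hb ⟨s, h⟩]
      split_ifs with h
      · apply S.dd_eq h
        rw [mul_zero, map_prod, eq_comm, sub_eq_zero]
        exact Finset.prod_congr rfl fun s _ =>
          (S.ex_f_of_ne _ _ _ _ (hne s) fun h => hb ⟨s, h⟩).symm
      · rfl
  rw [dunklOp_apply, hder, zero_add, Finset.sum_congr rfl fun b _ => hdd b, Finset.sum_comm]
  simp [← Finset.sum_mul]

/-- The kernel contributes the sum over all `y`, and the factors already present subtract the terms
with `y` in the range of `τ`. This cancellation is the source of the injectivity in `matchSum`. -/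
theorem dunklOp_prod_mul_kernel [DecidableEq Y] {a : X} {k : ℕ} {j : Fin k → X}
    (hj : Function.Injective j)
    (ha : a ∉ Set.range j) {τ : Fin k → Y} (hτ : Function.Injective τ) :
    S.dunklOp a ((∏ s, S.f (j s) (τ s)) * S.kernel) =
      (∑ y, if y ∈ Set.range τ then 0 else S.v y * S.f a y) * (∏ s, S.f (j s) (τ s)) *
        S.kernel := by
  rw [S.dunklOp_mul a _ fun b _ => S.ex_kernel a b, S.dunklOp_prod hj ha, S.der_kernel,
    sum_notMem_range hτ]
  ring

theorem dunklOp_v_mul (a : X) (y : Y) (F : R) :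
    S.dunklOp a (S.v y * F) = S.v y * S.dunklOp a F := by
  rw [mul_comm, S.dunklOp_mul a F fun b _ => S.ex_v a b y, S.der_v, mul_zero, add_zero, mul_comm]

theorem dunklOp_prod_v_mul (a : X) {k : ℕ} (τ : Fin k → Y) (F : R) :
    S.dunklOp a ((∏ s, S.v (τ s)) * F) = (∏ s, S.v (τ s)) * S.dunklOp a F := by
  induction k generalizing F with
  | zero => simp
  | succ k ih =>
    rw [Fin.prod_univ_succ, mul_assoc, S.dunklOp_v_mul, ih (fun s => τ s.succ), mul_assoc]

theorem opProd_dunklOp_kernel [DecidableEq Y] {k : ℕ} (j : Fin k → X)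
    (hj : Function.Injective j) :
    opProd (fun _ => S.dunklOp) j S.kernel =
      matchSum (fun a y => S.v y * S.f a y) j * S.kernel := by
  induction k with
  | zero => simp [opProd_zero, matchSum_zero]
  | succ k ih =>
    have hj' : Function.Injective fun s : Fin k => j s.succ := hj.comp (Fin.succ_injective k)
    have h0 : j 0 ∉ Set.range fun s : Fin k => j s.succ := by
      rintro ⟨s, hs⟩
      exact Fin.succ_ne_zero s (hj hs)
    rw [opProd_succ, Module.End.mul_apply, ih _ hj', matchSum_succ, matchSum, Finset.sum_mul,
      Finset.sum_mul, map_sum]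
    refine Finset.sum_congr rfl fun τ _ => ?_
    split_ifs with hτ
    · rw [Finset.prod_mul_distrib, mul_assoc, S.dunklOp_prod_v_mul,
        S.dunklOp_prod_mul_kernel hj' h0 hτ]
      ring
    · simp

/-- Multiplication by `x_a`. -/
def mulX (a : X) : Module.End K R := LinearMap.mulLeft K (S.x a)

/-- Since `x v f = f - 1`, multiplying by `x` costs the constant `1` for each of the unused `y`.
With `k` operators already applied there are `card Y - k` of these, which is exactly the shift of
the next operator. The parameter `u` keeps track of the shifts as operators are split off from the
left. -/
theorem opProd_mulX_dunklOp_kernel [DecidableEq Y] {k : ℕ} (j : Fin k → X)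
    (hj : Function.Injective j)
    (u : ℕ) (hu : u + k = Fintype.card Y) :
    opProd (fun s a => S.mulX a * S.dunklOp a +
        ((u + s + 1 : ℕ) : Module.End K R)) j S.kernel = matchSum S.f j * S.kernel := by
  induction k generalizing u with
  | zero => simp [opProd_zero, matchSum_zero]
  | succ k ih =>
    have hj' : Function.Injective fun s : Fin k => j s.succ := hj.comp (Fin.succ_injective k)
    have h0 : j 0 ∉ Set.range fun s : Fin k => j s.succ := by
      rintro ⟨s, hs⟩
      exact Fin.succ_ne_zero s (hj hs)
    have hih := ih _ hj' (u + 1) (by omega)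
    simp only [show ∀ s, u + 1 + s + 1 = u + (s + 1) + 1 by intro s; ring] at hih
    rw [opProd_succ, Module.End.mul_apply, hih, matchSum_succ, matchSum, Finset.sum_mul,
      Finset.sum_mul, map_sum]
    refine Finset.sum_congr rfl fun τ _ => ?_
    split_ifs with hτ
    · rw [LinearMap.add_apply, Module.End.mul_apply, mulX, LinearMap.mulLeft_apply,
        S.dunklOp_prod_mul_kernel hj' h0 hτ, Module.End.natCast_apply, sum_notMem_range hτ,
        sum_notMem_range hτ, nsmul_eq_mul]
      have hx : ∀ y, S.x (j 0) * (S.v y * S.f (j 0) y) = S.f (j 0) y - 1 := fun y => by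
        linear_combination -S.f_eq (j 0) y
      have hcard : (Fintype.card Y : R) = u + (k + 1) := by
        rw [← hu]; push_cast; ring
      have h1 : S.x (j 0) * ∑ y, S.v y * S.f (j 0) y =
          ∑ y, S.f (j 0) y - (u + (k + 1)) := by
        rw [Finset.mul_sum, Finset.sum_congr rfl fun y _ => hx y, Finset.sum_sub_distrib,
          ← hcard]
        simp
      have h2 : S.x (j 0) * ∑ s, S.v (τ s) * S.f (j 0) (τ s) =
          ∑ s, S.f (j 0) (τ s) - k := by
        rw [Finset.mul_sum, Finset.sum_congr rfl fun s _ => hx (τ s), Finset.sum_sub_distrib]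
        simp
      push_cast
      linear_combination (h1 - h2) * (∏ s, S.f (j (Fin.succ s)) (τ s)) * S.kernel
    · simp

end KernelSystem

end JackRodrigues

end

noncomputable section

namespace JackRodrigues

open MvPolynomial TensorProduct

/-! The reproducing kernel of the scalar product -/

/-- The size `∑ k m_k` of the partition with `m k` parts equal to `k`. -/
def size : (ℕ+ →₀ ℕ) →+ ℕ := Finsupp.weight fun k : ℕ+ => (k : ℕ)

theorem size_single (k : ℕ+) (c : ℕ) : size (Finsupp.single k c) = c * k := by
  rw [size, Finsupp.weight_single, smul_eq_mul]

theorem size_sub_single {m : ℕ+ →₀ ℕ} {r : ℕ+} (hr : m r ≠ 0) :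
    size (m - Finsupp.single r 1) + r = size m := by
  have h : Finsupp.single r 1 ≤ m := by
    rw [Finsupp.single_le_iff]
    omega
  conv_rhs => rw [← tsub_add_cancel_of_le h, map_add, size_single, one_mul]

theorem le_size {m : ℕ+ →₀ ℕ} {r : ℕ+} (hr : m r ≠ 0) : (r : ℕ) ≤ size m := by
  have := size_sub_single hr
  omega

theorem finite_size_eq (N : ℕ) : {m : ℕ+ →₀ ℕ | size m = N}.Finite := by
  classical
  refine (Set.finite_Iic (∑ k ∈ Finset.Icc 1 (Nat.succPNat N), Finsupp.single k N)).subset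
    fun m hm (k : ℕ+) => ?_
  have hm' : size m = N := hm
  rcases eq_or_ne (m k) 0 with h0 | h0
  · simp [h0]
  · have hk : (k : ℕ) ≤ N := hm' ▸ le_size h0
    have hk' : k ∈ Finset.Icc 1 (Nat.succPNat N) := by
      rw [Finset.mem_Icc]
      refine ⟨one_le, ?_⟩
      rw [← PNat.coe_le_coe]
      exact hk.trans (Nat.le_succ N)
    have hle : m k ≤ N := by
      have h1 : m k ≤ size m := Finsupp.le_weight (fun k : ℕ+ => (k : ℕ)) k.pos.ne' m
      rwa [hm'] at h1
    rw [Finsupp.finsetSum_apply]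
    simpa [Finsupp.single_apply, hk'] using hle

/-- The partitions of `N`. -/
def sizeSet (N : ℕ) : Finset (ℕ+ →₀ ℕ) := (finite_size_eq N).toFinset

theorem mem_sizeSet {N : ℕ} {m : ℕ+ →₀ ℕ} : m ∈ sizeSet N ↔ size m = N := by
  simp [sizeSet]

theorem zed_sub_single {m : ℕ+ →₀ ℕ} {r : ℕ+} (hr : m r ≠ 0) :
    zed m = m r * r * zed (m - Finsupp.single r 1) := by
  obtain ⟨m', rfl⟩ : ∃ m', m = m' + Finsupp.single r 1 := by
    refine ⟨m - Finsupp.single r 1, (tsub_add_cancel_of_le ?_).symm⟩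
    rw [Finsupp.single_le_iff]
    omega
  rw [add_tsub_cancel_right]
  have key (s : Finset ℕ+) (m : ℕ+ →₀ ℕ) (hs : m.support ⊆ s) :
      zed m = ∏ k ∈ s, (k : ℕ) ^ m k * (m k).factorial :=
    Finsupp.prod_of_support_subset m hs _ fun _ _ => by simp
  have hr' : r ∈ insert r m'.support := Finset.mem_insert_self _ _
  rw [key (insert r m'.support) (m' + Finsupp.single r 1) ?_,
    key (insert r m'.support) m' (Finset.subset_insert _ _), ← Finset.mul_prod_erase _ _ hr',
    ← Finset.mul_prod_erase (insert r m'.support) _ hr', Finset.prod_congr rfl (g := fun k : ℕ+ =>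
      (k : ℕ) ^ m' k * (m' k).factorial) fun k hk => ?_]
  · simp only [Finsupp.add_apply, Finsupp.single_eq_same, pow_succ, Nat.factorial_succ]
    ring
  · have := Finset.ne_of_mem_erase hk
    simp [this]
  · refine Finsupp.support_add.trans ?_
    intro k hk
    rcases Finset.mem_union.1 hk with h | h
    · exact Finset.mem_insert_of_mem h
    · have := Finsupp.support_single_subset h
      simp_all

theorem zed_ne_zero (m : ℕ+ →₀ ℕ) : zed m ≠ 0 :=
  Finset.prod_ne_zero_iff.2 fun k _ =>
    mul_ne_zero (pow_ne_zero _ k.pos.ne') (Nat.factorial_ne_zero _)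

/-! ### Power sums and the logarithmic derivative of the kernel -/

section Field

variable {K : Type*} [Field K]

/-- The value `z_μ α ^ ℓ(μ)` of `⟨p_μ, p_μ⟩`. -/
def norm (α : K) (m : ℕ+ →₀ ℕ) : K := (zed m : K) * α ^ m.degree

theorem norm_ne_zero [CharZero K] {α : K} (hα : α ≠ 0) (m : ℕ+ →₀ ℕ) : norm α m ≠ 0 :=
  mul_ne_zero (Nat.cast_ne_zero.2 (zed_ne_zero m)) (pow_ne_zero _ hα)

theorem norm_sub_single (α : K) {m : ℕ+ →₀ ℕ} {r : ℕ+} (hr : m r ≠ 0) :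
    norm α m = α * m r * (r : ℕ) * norm α (m - Finsupp.single r 1) := by
  have hdeg : m.degree = (m - Finsupp.single r 1).degree + 1 := by
    have h : Finsupp.single r 1 ≤ m := by
      rw [Finsupp.single_le_iff]
      omega
    conv_lhs => rw [← tsub_add_cancel_of_le h, map_add, Finsupp.degree_single]
  rw [norm, norm, zed_sub_single hr, hdeg, pow_succ]
  push_cast
  ring

/-- The product `p_μ(x_1, …, x_n)` of power sums. -/
def psumProd (K : Type*) [Field K] (n : ℕ) (m : ℕ+ →₀ ℕ) : MvPolynomial (Fin n) K :=
  toVars n (monomial m 1)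

theorem toVars_X (n : ℕ) (r : ℕ+) : toVars n (X r : SymFun K) = psum (Fin n) K r := by
  simp [toVars]

theorem psumProd_eq_mul (n : ℕ) {m : ℕ+ →₀ ℕ} {r : ℕ+} (hr : m r ≠ 0) :
    psumProd K n m = psum (Fin n) K r * psumProd K n (m - Finsupp.single r 1) := by
  have h : Finsupp.single r 1 ≤ m := by
    rw [Finsupp.single_le_iff]
    omega
  rw [psumProd, psumProd, ← toVars_X, ← map_mul, X, monomial_mul, one_mul,
    add_tsub_cancel_of_le h]

theorem pderiv_psum (n : ℕ) (a : Fin n) (r : ℕ+) :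
    pderiv a (psum (Fin n) K r) = ((r : ℕ) : K) • X a ^ ((r : ℕ) - 1) := by
  rw [psum, map_sum, Finset.sum_eq_single a]
  · simp [Algebra.smul_def]
  · intro b _ hb
    simp [pderiv_X_of_ne hb]
  · simp

/-- The chain rule through the power sums. The index set need only contain the support, so that it
stays fixed during the induction on `m`. -/
theorem pderiv_toVars_monomial (n : ℕ) (a : Fin n) (m : ℕ+ →₀ ℕ) (s : Finset ℕ+)
    (hs : m.support ⊆ s) :
    pderiv a (toVars n (monomial m (1 : K))) =
      ∑ r ∈ s, toVars n (pderiv r (monomial m 1)) * pderiv a (psum (Fin n) K r) := by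
  induction m using Finsupp.induction_linear with
  | zero => simp
  | add f g hf hg =>
    have hsupp : f.support ⊆ s ∧ g.support ⊆ s := by
      constructor <;> refine subset_trans (fun k hk => ?_) hs <;>
        simp only [Finsupp.mem_support_iff, Finsupp.add_apply] at hk ⊢ <;> omega
    have hmul : monomial (f + g) (1 : K) = monomial f 1 * monomial g 1 := by simp [monomial_mul]
    rw [hmul, map_mul, pderiv_mul, hf hsupp.1, hg hsupp.2, Finset.sum_mul, Finset.mul_sum,
      ← Finset.sum_add_distrib]
    refine Finset.sum_congr rfl fun r _ => ?_
    rw [pderiv_mul, map_add, map_mul, map_mul]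
    ring
  | single r k =>
    have hX : monomial (Finsupp.single r k) (1 : K) = X r ^ k := X_pow_eq_monomial.symm
    rw [hX, map_pow, pderiv_pow, toVars_X]
    rcases Nat.eq_zero_or_pos k with rfl | hk
    · simp
    · have hr : r ∈ s := hs (by simp [hk.ne'])
      rw [Finset.sum_eq_single_of_mem r hr]
      · rw [pderiv_pow, pderiv_X_self, map_mul, map_mul, map_pow, toVars_X]
        simp
      · intro r' _ hr'
        rw [pderiv_pow, pderiv_X_of_ne hr'.symm]
        simp

theorem pderiv_psumProd (n : ℕ) (a : Fin n) (m : ℕ+ →₀ ℕ) :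
    pderiv a (psumProd K n m) = ∑ r ∈ m.support, ((m r : K) * (r : ℕ)) •
      (X a ^ ((r : ℕ) - 1) * psumProd K n (m - Finsupp.single r 1)) := by
  rw [psumProd, pderiv_toVars_monomial n a m m.support subset_rfl]
  refine Finset.sum_congr rfl fun r _ => ?_
  rw [pderiv_monomial, one_mul, pderiv_psum, psumProd]
  have : monomial (m - Finsupp.single r 1) (m r : K) =
      (m r : K) • monomial (m - Finsupp.single r 1) 1 := by
    rw [smul_monomial, smul_eq_mul, mul_one]
  rw [this, map_smul, smul_mul_smul_comm, mul_comm (toVars n _)]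

theorem rename_psumProd {n : ℕ} (e : Equiv.Perm (Fin n)) (m : ℕ+ →₀ ℕ) :
    rename e (psumProd K n m) = psumProd K n m := by
  have : (rename e).comp (toVars (K := K) n) = toVars n := by
    apply algHom_ext
    intro r
    rw [AlgHom.comp_apply, toVars_X, rename_psum]
  exact DFunLike.congr_fun this _

/-- The homogeneous components of the reproducing kernel. -/
def kernelTerm (α : K) (n i N : ℕ) : MvPolynomial (Fin n) K ⊗[K] MvPolynomial (Fin i) K :=
  ∑ m ∈ sizeSet N, (norm α m)⁻¹ • (psumProd K n m ⊗ₜ psumProd K i m)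

/-- The reproducing kernel. -/
def kernelSeries (α : K) (n i : ℕ) :
    PowerSeries (MvPolynomial (Fin n) K ⊗[K] MvPolynomial (Fin i) K) :=
  PowerSeries.mk (kernelTerm α n i)

/-- This is the degree `N` part of `α ∂_a Π = (∑_r x_a^{r-1} p_r(y)) Π`. Differentiating `p_m(x)`
removes a part `r` with factor `m_r r`; with `α` this is exactly the ratio of norms in
`norm_sub_single`, and the same part is split off from `p_m(y)`. -/
theorem pderiv_kernelTerm [CharZero K] {α : K} (hα : α ≠ 0) (n i N : ℕ) (a : Fin n) :
    (α • (pderiv a).toLinearMap).rTensor (MvPolynomial (Fin i) K) (kernelTerm α n i N) =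
      ∑ p ∈ Finset.HasAntidiagonal.antidiagonal N with p.1 ≠ 0,
        ((X a ^ (p.1 - 1)) ⊗ₜ psum (Fin i) K p.1) * kernelTerm α n i p.2 := by
  have hterm : ∀ m : ℕ+ →₀ ℕ, (α • (pderiv a).toLinearMap).rTensor (MvPolynomial (Fin i) K)
      ((norm α m)⁻¹ • (psumProd K n m ⊗ₜ[K] psumProd K i m)) =
      ∑ r ∈ m.support, ((X a ^ ((r : ℕ) - 1)) ⊗ₜ psum (Fin i) K r) *
        ((norm α (m - Finsupp.single r 1))⁻¹ •
          (psumProd K n (m - Finsupp.single r 1) ⊗ₜ psumProd K i (m - Finsupp.single r 1))) := by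
    intro m
    rw [map_smul, LinearMap.rTensor_tmul, LinearMap.smul_apply, Derivation.coeFn_coe,
      pderiv_psumProd, Finset.smul_sum, sum_tmul, Finset.smul_sum]
    refine Finset.sum_congr rfl fun r hr => ?_
    have hr' : m r ≠ 0 := Finsupp.mem_support_iff.1 hr
    rw [psumProd_eq_mul i hr', mul_smul_comm, Algebra.TensorProduct.tmul_mul_tmul, smul_smul,
      ← smul_tmul', smul_smul, norm_sub_single α hr']
    congr 1
    have h1 : (m r : K) ≠ 0 := Nat.cast_ne_zero.2 hr'
    have h2 : ((r : ℕ) : K) ≠ 0 := Nat.cast_ne_zero.2 r.pos.ne'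
    have h3 := norm_ne_zero hα (m - Finsupp.single r 1)
    field_simp
  rw [kernelTerm, map_sum, Finset.sum_congr rfl fun m _ => hterm m]
  simp only [kernelTerm, Finset.mul_sum]
  rw [Finset.sum_sigma', Finset.sum_sigma']
  -- A pair (partition, one of its part sizes `r`) corresponds to `r` and the partition with one
  -- part `r` removed. The filter `p.1 ≠ 0` keeps `toPNat'` away from its default value.
  refine Finset.sum_bij' (fun q _ => ⟨((q.2 : ℕ), N - q.2), q.1 - Finsupp.single q.2 1⟩)
    (fun q _ => ⟨q.2 + Finsupp.single q.1.1.toPNat' 1, q.1.1.toPNat'⟩) ?_ ?_ ?_ ?_ ?_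
  · rintro ⟨m, r⟩ hq
    simp only [Finset.mem_sigma, mem_sizeSet, Finsupp.mem_support_iff, Finset.mem_filter,
      Finset.HasAntidiagonal.mem_antidiagonal] at hq ⊢
    have := size_sub_single hq.2
    exact ⟨⟨by omega, r.pos.ne'⟩, by omega⟩
  · rintro ⟨⟨r, s⟩, m⟩ hq
    simp only [Finset.mem_sigma, mem_sizeSet, Finsupp.mem_support_iff, Finset.mem_filter,
      Finset.HasAntidiagonal.mem_antidiagonal, map_add, size_single, Nat.toPNat'_coe] at hq ⊢
    rw [if_pos (Nat.pos_of_ne_zero hq.1.2)]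
    refine ⟨by omega, by simp⟩
  · rintro ⟨m, r⟩ hq
    simp only [Finset.mem_sigma, Finsupp.mem_support_iff] at hq
    have h : Finsupp.single r 1 ≤ m := by
      rw [Finsupp.single_le_iff]
      omega
    simp [tsub_add_cancel_of_le h]
  · rintro ⟨⟨r, s⟩, m⟩ hq
    simp only [Finset.mem_sigma, Finset.mem_filter, Finset.HasAntidiagonal.mem_antidiagonal] at hq
    have hs : N - r = s := by omega
    simp [Nat.pos_of_ne_zero hq.1.2, hs]
  · rintro ⟨m, r⟩ hq
    rfl

end Field

end JackRodrigues

end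

/-! ### The kernel as a power series over `K[x] ⊗ K[y]`, and the operators on it -/

noncomputable section

namespace JackRodrigues

open MvPolynomial TensorProduct

section

variable {K : Type*} [Field K]

/-- The linear operators on the algebra of power series with coefficients in `P`. -/
abbrev SeriesEnd (K P : Type*) [Field K] [CommRing P] [Algebra K P] : Type _ :=
  @Module.End K (PowerSeries P) _ _ Algebra.toModule

/-- A linear operator acting on the coefficients of power series. -/
def coeffwise (P : Type*) [CommRing P] [Algebra K P] :
    Module.End K P →+* SeriesEnd K P where
  toFun L :=
    { toFun := fun F => PowerSeries.mk fun N => L (PowerSeries.coeff N F)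
      map_add' := fun F G => by ext N; simp
      map_smul' := fun c F => by
        ext N
        -- The scalar action fixed in `SeriesEnd` comes from the algebra structure and is
        -- coefficientwise by definition.
        have h : ∀ (r : ℕ) (G : PowerSeries P),
            PowerSeries.coeff r (c • G) = c • PowerSeries.coeff r G := fun _ _ => rfl
        rw [PowerSeries.coeff_mk, h, map_smul, RingHom.id_apply, h, PowerSeries.coeff_mk] }
  map_one' := by ext F N; simp
  map_mul' L L' := by ext F N; simp
  map_zero' := by ext F N; simp
  map_add' L L' := by ext F N; simp

/-- An operator on polynomials in `x`, acting on power series with coefficients in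
`K[x] ⊗ K[y]`. -/
def liftOp (n i : ℕ) : Module.End K (MvPolynomial (Fin n) K) →+*
    SeriesEnd K (MvPolynomial (Fin n) K ⊗[K] MvPolynomial (Fin i) K) :=
  (coeffwise _).comp (Module.End.rTensorAlgHom K (MvPolynomial (Fin n) K)
    (MvPolynomial (Fin i) K)).toRingHom

theorem coeff_liftOp (n i N : ℕ) (L : Module.End K (MvPolynomial (Fin n) K))
    (F : PowerSeries (MvPolynomial (Fin n) K ⊗[K] MvPolynomial (Fin i) K)) :
    PowerSeries.coeff N (liftOp n i L F) =
      L.rTensor (MvPolynomial (Fin i) K) (PowerSeries.coeff N F) :=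
  PowerSeries.coeff_mk N fun N => L.rTensor (MvPolynomial (Fin i) K) (PowerSeries.coeff N F)

theorem liftOp_mulBy_apply (n i : ℕ) (p : MvPolynomial (Fin n) K)
    (F : PowerSeries (MvPolynomial (Fin n) K ⊗[K] MvPolynomial (Fin i) K)) :
    liftOp n i (mulBy p) F = PowerSeries.C (p ⊗ₜ 1) * F := by
  ext N
  rw [coeff_liftOp, PowerSeries.coeff_C_mul]
  have : (mulBy p).rTensor (MvPolynomial (Fin i) K) = LinearMap.mulLeft K (p ⊗ₜ 1) := by
    ext a b
    simp [mulBy]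
  rw [this, LinearMap.mulLeft_apply]

theorem liftOp_leibniz (n i : ℕ) (D : Derivation K (MvPolynomial (Fin n) K)
      (MvPolynomial (Fin n) K))
    (F G : PowerSeries (MvPolynomial (Fin n) K ⊗[K] MvPolynomial (Fin i) K)) :
    liftOp n i D.toLinearMap (F * G) =
      F • liftOp n i D.toLinearMap G + G • liftOp n i D.toLinearMap F := by
  have h : ∀ p q : MvPolynomial (Fin n) K ⊗[K] MvPolynomial (Fin i) K,
      D.toLinearMap.rTensor (MvPolynomial (Fin i) K) (p * q) =
        p * D.toLinearMap.rTensor (MvPolynomial (Fin i) K) q +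
          D.toLinearMap.rTensor (MvPolynomial (Fin i) K) p * q := by
    intro p q
    induction p with
    | zero => simp
    | add p p' hp hp' => rw [add_mul, map_add, hp, hp', map_add]; ring
    | tmul a b =>
      induction q with
      | zero => simp
      | add q q' hq hq' => rw [mul_add, map_add, hq, hq', map_add]; ring
      | tmul c d =>
        simp only [Algebra.TensorProduct.tmul_mul_tmul, LinearMap.rTensor_tmul,
          Derivation.coeFn_coe, Derivation.leibniz, smul_eq_mul, add_tmul]
        rw [mul_comm c]
  ext N
  rw [smul_eq_mul, smul_eq_mul, mul_comm G, coeff_liftOp, map_add, PowerSeries.coeff_mul,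
    PowerSeries.coeff_mul, PowerSeries.coeff_mul, map_sum, ← Finset.sum_add_distrib]
  exact Finset.sum_congr rfl fun q _ => by rw [h, coeff_liftOp, coeff_liftOp]

/-- The exchange of `x_a` and `x_b` on power series with coefficients in `K[x] ⊗ K[y]`. -/
def liftExchange (n i : ℕ) (a b : Fin n) :
    PowerSeries (MvPolynomial (Fin n) K ⊗[K] MvPolynomial (Fin i) K) →ₐ[K]
      PowerSeries (MvPolynomial (Fin n) K ⊗[K] MvPolynomial (Fin i) K) :=
  PowerSeries.mapAlgHom (Algebra.TensorProduct.map (exchange a b) (AlgHom.id K _))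

theorem coeff_liftExchange (n i N : ℕ) (a b : Fin n)
    (F : PowerSeries (MvPolynomial (Fin n) K ⊗[K] MvPolynomial (Fin i) K)) :
    PowerSeries.coeff N (liftExchange n i a b F) =
      Algebra.TensorProduct.map (exchange a b) (AlgHom.id K _) (PowerSeries.coeff N F) :=
  PowerSeries.coeff_map _ _ _

theorem liftOp_exchange (n i : ℕ) (a b : Fin n)
    (F : PowerSeries (MvPolynomial (Fin n) K ⊗[K] MvPolynomial (Fin i) K)) :
    liftOp n i (exchange a b).toLinearMap F = liftExchange n i a b F := by
  ext N
  rw [coeff_liftOp, coeff_liftExchange]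
  rfl

/-- `∑_r (t x_a y_k) ^ r`. -/
def geomSeries (K : Type*) [Field K] (n i : ℕ) (a : Fin n) (k : Fin i) :
    PowerSeries (MvPolynomial (Fin n) K ⊗[K] MvPolynomial (Fin i) K) :=
  PowerSeries.mk fun r => (X a ^ r) ⊗ₜ (X k ^ r)

/-- The variable `t y_k`. -/
def scaledVar (K : Type*) [Field K] (n i : ℕ) (k : Fin i) :
    PowerSeries (MvPolynomial (Fin n) K ⊗[K] MvPolynomial (Fin i) K) :=
  PowerSeries.X * PowerSeries.C (1 ⊗ₜ X k)

theorem coeff_zero_scaledVar_mul (n i : ℕ) (k : Fin i)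
    (F : PowerSeries (MvPolynomial (Fin n) K ⊗[K] MvPolynomial (Fin i) K)) :
    PowerSeries.coeff 0 (scaledVar K n i k * F) = 0 := by
  rw [scaledVar, mul_assoc, PowerSeries.coeff_zero_X_mul]

theorem coeff_succ_scaledVar_mul (n i N : ℕ) (k : Fin i)
    (F : PowerSeries (MvPolynomial (Fin n) K ⊗[K] MvPolynomial (Fin i) K)) :
    PowerSeries.coeff (N + 1) (scaledVar K n i k * F) =
      (1 ⊗ₜ X k) * PowerSeries.coeff N F := by
  rw [scaledVar, mul_assoc, PowerSeries.coeff_succ_X_mul, PowerSeries.coeff_C_mul]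

theorem derivation_mk'_apply {A : Type*} [CommRing A] [Algebra K A] (D : A →ₗ[K] A)
    (h : ∀ a b : A, D (a * b) = a • D b + b • D a) (a : A) : Derivation.mk' D h a = D a :=
  rfl

/-- The kernel, with the Dunkl operators that act on the variables `x`. -/
def kernelSystem [CharZero K] {α : K} (hα : α ≠ 0) (n i : ℕ) :
    KernelSystem K (PowerSeries (MvPolynomial (Fin n) K ⊗[K] MvPolynomial (Fin i) K))
      (Fin n) (Fin i) where
  x a := PowerSeries.C (X a ⊗ₜ 1)
  v := scaledVar K n i
  f := geomSeries K n i
  kernel := kernelSeries α n i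
  der a := Derivation.mk' (liftOp n i (α • pderiv a : Derivation K _ _).toLinearMap)
    (liftOp_leibniz n i _)
  ex := liftExchange n i
  dd a b := if h : a ≠ b then liftOp n i (dividedDifference a b h) else 0
  sub_mul_dd a b h F := by
    rw [dif_pos h, ← map_sub, ← sub_tmul, ← liftOp_mulBy_apply,
      ← Module.End.mul_apply, ← map_mul, ← liftOp_exchange]
    have : mulBy (X a - X b) * dividedDifference a b h = 1 - (exchange (K := K) a b).toLinearMap := by
      refine LinearMap.ext fun f => ?_
      exact X_sub_X_mul_dividedDifference a b h f
    rw [this, map_sub, map_one]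
    rfl
  cancel a b h F hF := by
    -- Multiplication by `x_a - x_b` is injective on `K[x]` and stays so after tensoring with the
    -- flat module `K[y]`.
    have hinj : Function.Injective ((mulBy (X a - X b : MvPolynomial (Fin n) K)).rTensor
        (MvPolynomial (Fin i) K)) :=
      Module.Flat.rTensor_preserves_injective_linearMap _
        (mul_right_injective₀ (X_sub_X_ne_zero h))
    rw [← map_sub, ← sub_tmul, ← liftOp_mulBy_apply] at hF
    ext N
    have := congrArg (PowerSeries.coeff N) hF
    rw [coeff_liftOp, map_zero] at this
    rw [map_zero]
    exact hinj (this.trans (map_zero _).symm)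
  f_eq a k := by
    ext N
    rw [map_add, mul_assoc, PowerSeries.coeff_C_mul]
    cases N with
    | zero =>
      rw [coeff_zero_scaledVar_mul, mul_zero, add_zero]
      simp [geomSeries, Algebra.TensorProduct.one_def]
    | succ N =>
      rw [coeff_succ_scaledVar_mul, PowerSeries.coeff_one, if_neg N.succ_ne_zero, zero_add]
      simp [geomSeries, Algebra.TensorProduct.tmul_mul_tmul, pow_succ']
  ex_f a b k := by
    ext N
    simp [coeff_liftExchange, geomSeries, exchange]
  ex_f_of_ne a b c k hca hcb := by
    ext N
    simp [coeff_liftExchange, geomSeries, exchange, Equiv.swap_apply_of_ne_of_ne hca hcb]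
  ex_v a b k := by
    ext N
    -- Writing `t y_k` as `t y_k * 1` turns its coefficients into shifted coefficients of `1`.
    rw [coeff_liftExchange, ← mul_one (scaledVar K n i k)]
    cases N with
    | zero => rw [coeff_zero_scaledVar_mul, map_zero]
    | succ N =>
      rw [coeff_succ_scaledVar_mul, PowerSeries.coeff_one]
      split_ifs <;> simp
  ex_kernel a b := by
    ext N
    rw [coeff_liftExchange, kernelSeries, PowerSeries.coeff_mk, kernelTerm, map_sum]
    refine Finset.sum_congr rfl fun m _ => ?_
    rw [map_smul, Algebra.TensorProduct.map_tmul, exchange, rename_psumProd]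
    rfl
  der_f a b k hb := by
    ext N
    rw [derivation_mk'_apply, coeff_liftOp, geomSeries, PowerSeries.coeff_mk,
      LinearMap.rTensor_tmul]
    simp [pderiv_X_of_ne hb]
  der_v a k := by
    ext N
    rw [derivation_mk'_apply, coeff_liftOp, ← mul_one (scaledVar K n i k)]
    cases N with
    | zero => rw [coeff_zero_scaledVar_mul, map_zero, map_zero]
    | succ N =>
      rw [coeff_succ_scaledVar_mul, PowerSeries.coeff_one]
      split_ifs <;> simp [Algebra.TensorProduct.one_def, Algebra.TensorProduct.tmul_mul_tmul]
  der_kernel a := by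
    ext N
    have hcoeff : ∀ r, PowerSeries.coeff r (∑ k, scaledVar K n i k * geomSeries K n i a k) =
        if r ≠ 0 then (X a ^ (r - 1)) ⊗ₜ psum (Fin i) K r else 0 := by
      intro r
      rw [map_sum]
      cases r with
      | zero => simp [coeff_zero_scaledVar_mul]
      | succ r =>
        rw [if_pos r.succ_ne_zero, psum, tmul_sum]
        refine Finset.sum_congr rfl fun k _ => ?_
        rw [coeff_succ_scaledVar_mul, geomSeries, PowerSeries.coeff_mk,
          Algebra.TensorProduct.tmul_mul_tmul, one_mul, ← pow_succ']
        rfl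
    rw [derivation_mk'_apply, coeff_liftOp, PowerSeries.coeff_mul, kernelSeries,
      PowerSeries.coeff_mk]
    simp only [hcoeff, PowerSeries.coeff_mk, ite_mul, zero_mul]
    rw [← Finset.sum_filter]
    exact pderiv_kernelTerm hα n i N a

theorem liftOp_rationalDunkl [CharZero K] {α : K} (hα : α ≠ 0) (n i : ℕ) (a : Fin n) :
    liftOp n i (rationalDunkl α a) = (kernelSystem hα n i).dunklOp a := by
  rw [rationalDunkl, map_add, map_sum, KernelSystem.dunklOp]
  congr 1
  refine Finset.sum_congr rfl fun b _ => ?_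
  by_cases h : a ≠ b
  · rw [dif_pos h, if_pos h]
    change _ = if h : a ≠ b then liftOp n i (dividedDifference a b h) else 0
    rw [dif_pos h]
  · rw [dif_neg h, if_neg h, map_zero]

theorem liftOp_shiftedDunkl [CharZero K] {α : K} (hα : α ≠ 0) (n i s : ℕ) (a : Fin n) :
    liftOp n i (shiftedDunkl α s a) =
      (kernelSystem hα n i).mulX a * (kernelSystem hα n i).dunklOp a +
        ((s : ℕ) : SeriesEnd K _) := by
  have h : liftOp n i (mulBy (X a)) = (kernelSystem hα n i).mulX a :=
    LinearMap.ext fun F => liftOp_mulBy_apply n i (X a) F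
  rw [shiftedDunkl, map_add, map_natCast, dunkl_eq, map_mul, h, liftOp_rationalDunkl hα]

theorem map_opProd {R R' σ : Type*} [Semiring R] [Semiring R'] (φ : R →+* R') (E : ℕ → σ → R) {k : ℕ}
    (j : Fin k → σ) : φ (opProd E j) = opProd (fun s a => φ (E s a)) j := by
  rw [opProd, opProd, map_list_prod, List.map_ofFn]
  rfl

theorem liftOp_dunklProd_kernelSeries [CharZero K] {α : K} (hα : α ≠ 0) (n i : ℕ)
    (J : Finset (Fin n)) (hJ : J.card = i) :
    liftOp n i (dunklProd α J) (kernelSeries α n i) =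
      matchSum (geomSeries K n i) (J.orderEmbOfFin hJ) * kernelSeries α n i := by
  subst hJ
  -- There are as many variables `y` as elements of `J`, hence `u = 0` and the shifts are `1, …,
  -- |J|`.
  have h := (kernelSystem hα n J.card).opProd_mulX_dunklOp_kernel (J.orderEmbOfFin rfl)
    (J.orderEmbOfFin rfl).injective 0 (by simp)
  rw [dunklProd_eq, map_opProd]
  simp only [liftOp_shiftedDunkl hα]
  simp only [zero_add] at h
  exact h

theorem liftOp_rationalDunkl_kernelSeries [CharZero K] {α : K} (hα : α ≠ 0) (n i : ℕ) :
    liftOp n i (opProd (fun _ => rationalDunkl α) id) (kernelSeries α n i) =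
      matchSum (fun a k => scaledVar K n i k * geomSeries K n i a k) id * kernelSeries α n i := by
  have h := (kernelSystem hα n i).opProd_dunklOp_kernel id Function.injective_id
  rw [map_opProd]
  simp only [liftOp_rationalDunkl hα]
  exact h

end

end JackRodrigues

end

/-! ### Creation operators as adjoints of products of rational Dunkl operators -/

noncomputable section

namespace JackRodrigues

open MvPolynomial TensorProduct

section

variable {K : Type*} [Field K]

/-- The exchange of the two sets of variables. -/
def swapSeries (K : Type*) [Field K] (n i : ℕ) :
    PowerSeries (MvPolynomial (Fin i) K ⊗[K] MvPolynomial (Fin n) K) →+*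
      PowerSeries (MvPolynomial (Fin n) K ⊗[K] MvPolynomial (Fin i) K) :=
  PowerSeries.map (Algebra.TensorProduct.comm K (MvPolynomial (Fin i) K)
    (MvPolynomial (Fin n) K)).toAlgHom.toRingHom

theorem coeff_swapSeries (n i N : ℕ)
    (F : PowerSeries (MvPolynomial (Fin i) K ⊗[K] MvPolynomial (Fin n) K)) :
    PowerSeries.coeff N (swapSeries K n i F) =
      TensorProduct.comm K (MvPolynomial (Fin i) K) (MvPolynomial (Fin n) K)
        (PowerSeries.coeff N F) :=
  PowerSeries.coeff_map _ _ _

theorem swapSeries_kernelSeries (α : K) (n i : ℕ) :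
    swapSeries K n i (kernelSeries α i n) = kernelSeries α n i := by
  ext N
  rw [coeff_swapSeries, kernelSeries, kernelSeries, PowerSeries.coeff_mk, PowerSeries.coeff_mk,
    kernelTerm, kernelTerm, map_sum]
  refine Finset.sum_congr rfl fun m _ => ?_
  rw [map_smul, TensorProduct.comm_tmul]

theorem swapSeries_geomSeries (n i : ℕ) (a : Fin n) (k : Fin i) :
    swapSeries K n i (geomSeries K i n k a) = geomSeries K n i a k := by
  ext N
  rw [coeff_swapSeries, geomSeries, geomSeries, PowerSeries.coeff_mk, PowerSeries.coeff_mk,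
    TensorProduct.comm_tmul]

theorem swapSeries_scaledVar (n i : ℕ) (a : Fin n) :
    swapSeries K n i (scaledVar K i n a) = PowerSeries.X * PowerSeries.C (X a ⊗ₜ 1) := by
  rw [scaledVar, map_mul, swapSeries, PowerSeries.map_X, PowerSeries.map_C]
  rfl

theorem coeff_swapSeries_liftOp (n i N : ℕ) (L : Module.End K (MvPolynomial (Fin i) K))
    (F : PowerSeries (MvPolynomial (Fin i) K ⊗[K] MvPolynomial (Fin n) K)) :
    PowerSeries.coeff N (swapSeries K n i (liftOp i n L F)) =
      L.lTensor (MvPolynomial (Fin n) K) (PowerSeries.coeff N (swapSeries K n i F)) := by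
  rw [coeff_swapSeries, coeff_swapSeries, coeff_liftOp]
  generalize PowerSeries.coeff N F = p
  induction p with
  | zero => simp
  | add p q hp hq => rw [map_add, map_add, hp, hq, map_add, map_add]
  | tmul a b => simp

theorem matchSum_scaled (n i : ℕ) (J : Finset (Fin n)) (hJ : J.card = i) :
    matchSum (fun a k => PowerSeries.X * PowerSeries.C ((X a : MvPolynomial (Fin n) K) ⊗ₜ[K] 1) *
        geomSeries K n i a k) (J.orderEmbOfFin hJ) =
      PowerSeries.X ^ i * (PowerSeries.C ((∏ j ∈ J, X j) ⊗ₜ[K] 1) *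
        matchSum (geomSeries K n i) (J.orderEmbOfFin hJ)) := by
  have hprod : ∏ s : Fin i, (PowerSeries.X *
      PowerSeries.C ((X (J.orderEmbOfFin hJ s) : MvPolynomial (Fin n) K) ⊗ₜ[K]
        (1 : MvPolynomial (Fin i) K))) =
      PowerSeries.X ^ i * PowerSeries.C ((∏ j ∈ J, X j : MvPolynomial (Fin n) K) ⊗ₜ[K]
        (1 : MvPolynomial (Fin i) K)) := by
    rw [Finset.prod_mul_distrib, Finset.prod_const, Finset.card_univ, Fintype.card_fin,
      ← map_prod]
    congr 2
    rw [← Finset.prod_coe_sort J, ← Equiv.prod_comp (J.orderIsoOfFin hJ).toEquiv]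
    exact (map_prod (Algebra.TensorProduct.includeLeft (R := K) (S := K)
      (A := MvPolynomial (Fin n) K) (B := MvPolynomial (Fin i) K))
      (fun s : Fin i => X (J.orderEmbOfFin hJ s)) Finset.univ).symm
  rw [matchSum, matchSum, ← mul_assoc, Finset.mul_sum]
  refine Finset.sum_congr rfl fun τ _ => ?_
  split_ifs
  · rw [Finset.prod_mul_distrib, hprod]
  · rw [mul_zero]

/-- Each `x_J D_J` gives the matchings of `J` with the `y` variables, and the sum over `J` gives all
injections `Fin i → Fin n`. The same sum arises when `T_1 ⋯ T_i` acts on the kernel with the two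
sets of variables exchanged. -/
theorem creation_kernelTerm [CharZero K] {α : K} (hα : α ≠ 0) (n i N : ℕ) :
    (creation α n i).rTensor (MvPolynomial (Fin i) K) (kernelTerm α n i N) =
      (opProd (fun _ => rationalDunkl α) id : Module.End K (MvPolynomial (Fin i) K)).lTensor
        (MvPolynomial (Fin n) K) (kernelTerm α n i (N + i)) := by
  have hleft : PowerSeries.X ^ i * liftOp n i (creation α n i) (kernelSeries α n i) =
      (∑ J ∈ (Finset.powersetCard i (Finset.univ : Finset (Fin n))).attach,
        matchSum (fun a k => PowerSeries.X * PowerSeries.C ((X a : MvPolynomial (Fin n) K) ⊗ₜ 1) *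
          geomSeries K n i a k) (J.1.orderEmbOfFin (Finset.mem_powersetCard.1 J.2).2)) *
        kernelSeries α n i := by
    rw [creation, ← Finset.sum_attach, map_sum, LinearMap.sum_apply, Finset.mul_sum,
      Finset.sum_mul]
    refine Finset.sum_congr rfl fun J _ => ?_
    rw [matchSum_scaled, map_mul, Module.End.mul_apply,
      liftOp_dunklProd_kernelSeries hα n i J.1 (Finset.mem_powersetCard.1 J.2).2,
      liftOp_mulBy_apply]
    ring
  have hright : swapSeries K n i
      (liftOp i n (opProd (fun _ => rationalDunkl α) id) (kernelSeries α i n)) =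
      PowerSeries.X ^ i * liftOp n i (creation α n i) (kernelSeries α n i) := by
    rw [hleft, liftOp_rationalDunkl_kernelSeries hα, map_mul, swapSeries_kernelSeries,
      ← sum_injective_eq_sum_powersetCard fun a k => PowerSeries.X *
        PowerSeries.C ((X a : MvPolynomial (Fin n) K) ⊗ₜ 1) * geomSeries K n i a k,
      matchSum, map_sum]
    congr 1
    refine Finset.sum_congr rfl fun τ _ => ?_
    split_ifs
    · rw [map_prod]
      refine Finset.prod_congr rfl fun k _ => ?_
      rw [map_mul, swapSeries_scaledVar, swapSeries_geomSeries]
      rfl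
    · rw [map_zero]
  -- The factor `t^i`, one `t` for each matched pair, accounts for the shift from `N` to `N + i`.
  have h := congrArg (PowerSeries.coeff (N + i)) hright
  rw [PowerSeries.coeff_X_pow_mul, coeff_swapSeries_liftOp, swapSeries_kernelSeries,
    coeff_liftOp, kernelSeries, PowerSeries.coeff_mk, PowerSeries.coeff_mk] at h
  exact h.symm

/-! Symmetric functions from linear functionals on polynomials -/

/-- The symmetric function of degree `N` whose scalar product with `g` is the value of `ψ` at
`g(y_1, …, y_i)`. -/
def dualFun (α : K) (i N : ℕ) (ψ : MvPolynomial (Fin i) K →ₗ[K] K) : SymFun K :=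
  ∑ m ∈ sizeSet N, ((norm α m)⁻¹ * ψ (psumProd K i m)) • monomial m 1

/-- The contraction of `K[x] ⊗ K[y]` with a functional on `K[y]`. -/
def contract (n i : ℕ) (ψ : MvPolynomial (Fin i) K →ₗ[K] K) :
    MvPolynomial (Fin n) K ⊗[K] MvPolynomial (Fin i) K →ₗ[K] MvPolynomial (Fin n) K :=
  (TensorProduct.rid K (MvPolynomial (Fin n) K)).toLinearMap ∘ₗ
    ψ.lTensor (MvPolynomial (Fin n) K)

theorem contract_tmul (n i : ℕ) (ψ : MvPolynomial (Fin i) K →ₗ[K] K)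
    (p : MvPolynomial (Fin n) K) (q : MvPolynomial (Fin i) K) :
    contract n i ψ (p ⊗ₜ q) = ψ q • p := by
  simp [contract]

theorem toVars_dualFun (α : K) (n i N : ℕ) (ψ : MvPolynomial (Fin i) K →ₗ[K] K) :
    toVars n (dualFun α i N ψ) = contract n i ψ (kernelTerm α n i N) := by
  rw [dualFun, kernelTerm, map_sum, map_sum]
  refine Finset.sum_congr rfl fun m _ => ?_
  rw [map_smul, map_smul, contract_tmul, smul_smul]
  rfl

/-- `B_i^+` acts on `x` and `ψ` on `y`, so the two commute, and the adjointness on the kernel moves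
the operator onto the functional. The new functional does not involve `n`. -/
theorem creation_toVars_dualFun [CharZero K] {α : K} (hα : α ≠ 0) (n i N : ℕ)
    (ψ : MvPolynomial (Fin i) K →ₗ[K] K) :
    creation α n i (toVars n (dualFun α i N ψ)) =
      toVars n (dualFun α i (N + i) (ψ ∘ₗ opProd (fun _ => rationalDunkl α) id)) := by
  have h1 : ∀ p, creation α n i (contract n i ψ p) =
      contract n i ψ ((creation α n i).rTensor (MvPolynomial (Fin i) K) p) := by
    intro p
    induction p with
    | zero => simp
    | add p q hp hq => simp only [map_add, hp, hq]
    | tmul a b => rw [contract_tmul, LinearMap.rTensor_tmul, contract_tmul, map_smul]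
  have h2 : ∀ (L : Module.End K (MvPolynomial (Fin i) K)) p,
      contract n i ψ (L.lTensor (MvPolynomial (Fin n) K) p) = contract n i (ψ ∘ₗ L) p := by
    intro L p
    induction p with
    | zero => simp
    | add p q hp hq => simp only [map_add, hp, hq]
    | tmul a b => rw [LinearMap.lTensor_tmul, contract_tmul, contract_tmul, LinearMap.comp_apply]
  rw [toVars_dualFun, h1, creation_kernelTerm hα, h2, toVars_dualFun]

/-- The specialization of the last variable to zero. -/
def killLast (K : Type*) [Field K] (i : ℕ) :
    MvPolynomial (Fin (i + 1)) K →ₐ[K] MvPolynomial (Fin i) K :=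
  killCompl (Fin.castSucc_injective i)

theorem killCompl_psum {m n : ℕ} {e : Fin m → Fin n} (he : Function.Injective e) (r : ℕ+) :
    killCompl he (psum (Fin n) K r) = psum (Fin m) K r := by
  classical
  rw [psum, psum, map_sum, ← Finset.sum_subset (Finset.subset_univ (Finset.univ.image e)),
    Finset.sum_image he.injOn]
  · refine Finset.sum_congr rfl fun a _ => ?_
    rw [map_pow, ← rename_X (R := K) e a, killCompl_rename_app]
  · intro b _ hb
    have hb' : b ∉ Set.range e := by
      rintro ⟨a, rfl⟩
      exact hb (Finset.mem_image_of_mem _ (Finset.mem_univ a))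
    rw [map_pow, killCompl, aeval_X, dif_neg hb', zero_pow r.pos.ne']

theorem killCompl_toVars {m n : ℕ} {e : Fin m → Fin n} (he : Function.Injective e)
    (f : SymFun K) : killCompl he (toVars n f) = toVars m f := by
  have : (killCompl he).comp (toVars (K := K) n) = toVars m := by
    apply algHom_ext
    intro r
    rw [AlgHom.comp_apply, toVars_X, killCompl_psum, toVars_X]
  exact DFunLike.congr_fun this f

/-- Adjointness for `B_{i+1}^+` requires exactly `i + 1` variables `y`. Precomposing the functional
with `y_{i+1} = 0` supplies them without changing the symmetric function. -/
theorem dualFun_comp_killLast (α : K) (i N : ℕ) (ψ : MvPolynomial (Fin i) K →ₗ[K] K) :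
    dualFun α (i + 1) N (ψ ∘ₗ (killLast K i).toLinearMap) = dualFun α i N ψ := by
  refine Finset.sum_congr rfl fun m _ => ?_
  have h : (killLast K i).toLinearMap (psumProd K (i + 1) m) = psumProd K i m :=
    killCompl_toVars (Fin.castSucc_injective i) _
  rw [LinearMap.comp_apply, h]

/-- The functional `g ↦ ⟨J_λ, g⟩`, where `d k` is the number of columns of length `k` of `λ`,
and `λ` has at most `i` parts. -/
def jackFunctional (α : K) (d : ℕ → ℕ) : (i : ℕ) → MvPolynomial (Fin i) K →ₗ[K] K
  | 0 => lcoeff K 0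
  | i + 1 => (jackFunctional α d i ∘ₗ (killLast K i).toLinearMap) ∘ₗ
      (opProd (fun _ => rationalDunkl α) id : Module.End K (MvPolynomial (Fin (i + 1)) K)) ^
        d (i + 1)

/-- The size of the partition with `d k` columns of length `k ≤ i`. -/
def columnSize (d : ℕ → ℕ) (i : ℕ) : ℕ := ∑ k ∈ Finset.range i, (k + 1) * d (k + 1)

/-- The Jack function of the partition with `d k` columns of length `k ≤ i`. -/
def jackFun (α : K) (d : ℕ → ℕ) (i : ℕ) : SymFun K :=
  dualFun α i (columnSize d i) (jackFunctional α d i)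

theorem creation_pow_toVars_dualFun [CharZero K] {α : K} (hα : α ≠ 0) (n i N k : ℕ)
    (ψ : MvPolynomial (Fin i) K →ₗ[K] K) :
    (creation α n i ^ k) (toVars n (dualFun α i N ψ)) =
      toVars n (dualFun α i (N + i * k) (ψ ∘ₗ (opProd (fun _ => rationalDunkl α) id :
        Module.End K (MvPolynomial (Fin i) K)) ^ k)) := by
  induction k with
  | zero => rfl
  | succ k ih =>
    rw [pow_succ', Module.End.mul_apply, ih, creation_toVars_dualFun hα, LinearMap.comp_assoc,
      ← Module.End.mul_eq_comp, ← pow_succ, mul_add, mul_one, add_assoc]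

theorem toVars_jackFun_succ [CharZero K] {α : K} (hα : α ≠ 0) (d : ℕ → ℕ) (n i : ℕ) :
    toVars n (jackFun α d (i + 1)) =
      (creation α n (i + 1) ^ d (i + 1)) (toVars n (jackFun α d i)) := by
  rw [jackFun, jackFun, ← dualFun_comp_killLast α i, creation_pow_toVars_dualFun hα, columnSize,
    Finset.sum_range_succ, jackFunctional]
  rfl

theorem toVars_jackFun_zero (α : K) (d : ℕ → ℕ) (n : ℕ) :
    toVars n (jackFun α d 0) = 1 := by
  have h : sizeSet 0 = {0} := by
    ext m
    rw [mem_sizeSet, Finset.mem_singleton]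
    constructor
    · intro hm
      by_contra hne
      obtain ⟨r, hr⟩ := Finsupp.ne_iff.1 hne
      have := le_size hr
      have := r.pos
      omega
    · rintro rfl
      exact map_zero _
  have h1 : psumProd K 0 0 = 1 := by simp [psumProd]
  have h2 : norm α 0 = 1 := by simp [norm, zed]
  rw [jackFun, columnSize, Finset.sum_range_zero, dualFun, h, Finset.sum_singleton, h1, h2,
    jackFunctional]
  simp

theorem toVars_jackFun [CharZero K] {α : K} (hα : α ≠ 0) (d : ℕ → ℕ) (n i : ℕ) :
    toVars n (jackFun α d i) =
      (List.ofFn fun k : Fin i => creation α n (i - k) ^ d (i - k)).prod 1 := by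
  induction i with
  | zero => simp [toVars_jackFun_zero]
  | succ i ih =>
    rw [toVars_jackFun_succ hα, ih, List.ofFn_succ, List.prod_cons, Module.End.mul_apply]
    simp

end

end JackRodrigues

end

noncomputable section

namespace JackRodrigues

open MvPolynomial

/-! The scalar product -/

section

variable {K : Type*} [Field K]

theorem scalarProduct_eq_sum (α : K) {f g : SymFun K} {s : Finset (ℕ+ →₀ ℕ)}
    (hs : ∀ m, coeff m f ≠ 0 → coeff m g ≠ 0 → m ∈ s) :
    scalarProduct α f g = ∑ m ∈ s, coeff m f * coeff m g * norm α m := by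
  classical
  have h1 : scalarProduct α f g = ∑ m ∈ f.support ∪ s, coeff m f * coeff m g * norm α m := by
    refine Finset.sum_subset Finset.subset_union_left fun m _ hm => ?_
    rw [notMem_support_iff.1 hm, zero_mul, zero_mul]
  rw [h1]
  refine (Finset.sum_subset Finset.subset_union_right fun m _ hm => ?_).symm
  by_contra hne
  exact hm (hs m (left_ne_zero_of_mul (left_ne_zero_of_mul hne))
    (right_ne_zero_of_mul (left_ne_zero_of_mul hne)))

/-- The scalar product, as a bilinear form. -/
def scalarForm (α : K) : SymFun K →ₗ[K] SymFun K →ₗ[K] K :=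
  LinearMap.mk₂ K (scalarProduct α)
    (fun f f' g => by
      classical
      rw [scalarProduct_eq_sum α (f := f) (s := g.support) fun m _ h => mem_support_iff.2 h,
        scalarProduct_eq_sum α (f := f') (s := g.support) fun m _ h => mem_support_iff.2 h,
        scalarProduct_eq_sum α (s := g.support) fun m _ h => mem_support_iff.2 h,
        ← Finset.sum_add_distrib]
      exact Finset.sum_congr rfl fun m _ => by rw [coeff_add]; ring)
    (fun c f g => by
      rw [scalarProduct_eq_sum α (f := f) (s := g.support) fun m _ h => mem_support_iff.2 h,
        scalarProduct_eq_sum α (s := g.support) fun m _ h => mem_support_iff.2 h, Finset.smul_sum]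
      exact Finset.sum_congr rfl fun m _ => by rw [coeff_smul, smul_eq_mul, smul_eq_mul]; ring)
    (fun f g g' => by
      rw [scalarProduct, scalarProduct, scalarProduct, ← Finset.sum_add_distrib]
      exact Finset.sum_congr rfl fun m _ => by rw [coeff_add]; ring)
    (fun c f g => by
      rw [scalarProduct, scalarProduct, Finset.smul_sum]
      exact Finset.sum_congr rfl fun m _ => by rw [coeff_smul, smul_eq_mul, smul_eq_mul]; ring)

theorem scalarProduct_comm (α : K) (f g : SymFun K) :
    scalarProduct α f g = scalarProduct α g f := by
  rw [scalarProduct_eq_sum α (f := g) (s := f.support) fun m _ h => mem_support_iff.2 h]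
  exact Finset.sum_congr rfl fun m _ => by rw [norm]; ring

theorem coeff_dualFun (α : K) (i N : ℕ) (ψ : MvPolynomial (Fin i) K →ₗ[K] K) (m : ℕ+ →₀ ℕ) :
    coeff m (dualFun α i N ψ) = if size m = N then (norm α m)⁻¹ * ψ (psumProd K i m) else 0 := by
  rw [dualFun, coeff_sum]
  simp only [coeff_smul, coeff_monomial, smul_eq_mul, mul_ite, mul_one, mul_zero]
  rw [Finset.sum_ite_eq']
  simp only [mem_sizeSet]

/-- The reproducing property: the weights `(norm α m)⁻¹` of the kernel cancel those of the scalar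
product. -/
theorem scalarProduct_dualFun [CharZero K] {α : K} (hα : α ≠ 0) (i N : ℕ)
    (ψ : MvPolynomial (Fin i) K →ₗ[K] K) {g : SymFun K}
    (hg : ∀ m, coeff m g ≠ 0 → size m = N) :
    scalarProduct α (dualFun α i N ψ) g = ψ (toVars i g) := by
  rw [scalarProduct_eq_sum α (s := g.support) fun m _ h => mem_support_iff.2 h]
  conv_rhs => rw [g.as_sum, map_sum, map_sum]
  refine Finset.sum_congr rfl fun m hm => ?_
  have h : monomial m (coeff m g) = coeff m g • monomial m (1 : K) := by
    rw [smul_monomial, smul_eq_mul, mul_one]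
  rw [coeff_dualFun, if_pos (hg m (mem_support_iff.1 hm)), h, map_smul, map_smul, smul_eq_mul,
    psumProd]
  have := norm_ne_zero hα m
  field_simp

theorem size_of_coeff_jackFun {α : K} {d : ℕ → ℕ} {i : ℕ} {m : ℕ+ →₀ ℕ}
    (hm : coeff m (jackFun α d i) ≠ 0) : size m = columnSize d i := by
  rw [jackFun, coeff_dualFun] at hm
  by_contra h
  exact hm (if_neg h)

theorem scalarProduct_jackFun_of_ne (α : K) (d d' : ℕ → ℕ) (i i' : ℕ)
    (h : columnSize d i ≠ columnSize d' i') :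
    scalarProduct α (jackFun α d i) (jackFun α d' i') = 0 := by
  rw [scalarProduct_eq_sum α (s := ∅), Finset.sum_empty]
  intro m h1 h2
  exact absurd ((size_of_coeff_jackFun h1).symm.trans (size_of_coeff_jackFun h2)) h

end

/-! Dominance properties of the Jack functions -/

/-- A partial sum over `S` gains at most `min |S| |J|`, while a set of `min |S| |τ|` indices of `b +
1` gains its full size; it can be chosen to contain the set `T` provided by `h`. -/
theorem dominated_add_indicator {σ τ : Type*} [DecidableEq σ] [Fintype τ] {a : σ → ℕ} {b : τ → ℕ}
    (h : Dominated a b) (J : Finset σ) (hJ : J.card ≤ Fintype.card τ) :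
    Dominated (a + indicator J) (b + 1) := by
  intro S
  obtain ⟨T, hT, hle⟩ := h S
  obtain ⟨U, hTU, hU⟩ := Finset.exists_superset_card_eq (n := min S.card (Fintype.card τ))
    (le_min hT (Finset.card_le_univ T)) (min_le_right _ _)
  refine ⟨U, hU.trans_le (min_le_left _ _), ?_⟩
  simp only [Pi.add_apply, Pi.one_apply, Finset.sum_add_distrib, sum_indicator,
    Finset.sum_const, smul_eq_mul, mul_one]
  have h1 : ∑ t ∈ T, b t ≤ ∑ t ∈ U, b t := Finset.sum_le_sum_of_subset hTU
  have h2 : (S ∩ J).card ≤ S.card := Finset.card_le_card Finset.inter_subset_left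
  have h3 : (S ∩ J).card ≤ J.card := Finset.card_le_card Finset.inter_subset_right
  omega

theorem dominated_of_injective {σ τ : Type*} {a : σ → ℕ} {b : τ → ℕ} {e : τ → σ}
    (he : Function.Injective e) (h0 : ∀ s, s ∉ Set.range e → a s = 0) (h : ∀ t, a (e t) ≤ b t) :
    Dominated a b := by
  intro S
  refine ⟨S.preimage e he.injOn, ?_, ?_⟩
  · exact Finset.card_le_card_of_injOn e (fun t ht => by simpa using ht) he.injOn
  · rw [← Finset.sum_preimage e S he.injOn a fun s _ hs => h0 s hs]
    exact Finset.sum_le_sum fun t _ => h t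

theorem dominated_comp {σ τ : Type*} (a : σ → ℕ) {e : τ → σ}
    (he : Function.Injective e) : Dominated (a ∘ e) a := by
  intro S
  refine ⟨S.map ⟨e, he⟩, (Finset.card_map _).le, ?_⟩
  simp

/-- The parts of the partition with `d k` columns of length `k ≤ i`. -/
def columnParts (d : ℕ → ℕ) (i : ℕ) (j : Fin i) : ℕ := ∑ k ∈ Finset.Ico (j : ℕ) i, d (k + 1)

theorem columnParts_succ (d : ℕ → ℕ) (i : ℕ) (j : Fin (i + 1)) :
    columnParts d (i + 1) j = (∑ k ∈ Finset.Ico (j : ℕ) i, d (k + 1)) + d (i + 1) := by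
  rw [columnParts, Finset.sum_Ico_succ_top (Nat.lt_succ_iff.1 j.2)]

/-- Appending a zero row does not affect dominance; this allows the passage from `Fin i` to `Fin (i
+ 1)`. -/
theorem dominated_columnParts_iff (d : ℕ → ℕ) (i : ℕ) :
    Dominated (fun j : Fin (i + 1) => ∑ k ∈ Finset.Ico (j : ℕ) i, d (k + 1)) (columnParts d i) ∧
      Dominated (columnParts d i)
        (fun j : Fin (i + 1) => ∑ k ∈ Finset.Ico (j : ℕ) i, d (k + 1)) := by
  constructor
  · refine dominated_of_injective (Fin.castSucc_injective i) ?_ fun t => le_rfl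
    intro s hs
    have : s = Fin.last i := by
      by_contra hne
      exact hs ⟨s.castPred hne, Fin.castSucc_castPred s hne⟩
    simp [this]
  · exact dominated_comp (fun j : Fin (i + 1) => ∑ k ∈ Finset.Ico (j : ℕ) i, d (k + 1))
      (Fin.castSucc_injective i)

section

variable {K : Type*} [Field K]

theorem exists_coeff_of_linearMap_ne_zero {n : ℕ} (ψ : MvPolynomial (Fin n) K →ₗ[K] K)
    {f : MvPolynomial (Fin n) K} (h : ψ f ≠ 0) :
    ∃ a, coeff a f ≠ 0 ∧ ψ (monomial a 1) ≠ 0 := by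
  rw [f.as_sum, map_sum] at h
  obtain ⟨a, ha, hne⟩ := Finset.exists_ne_zero_of_sum_ne_zero h
  refine ⟨a, mem_support_iff.1 ha, fun h0 => hne ?_⟩
  have h : monomial a (coeff a f) = coeff a f • monomial a (1 : K) := by
    rw [smul_monomial, smul_eq_mul, mul_one]
  rw [h, map_smul, h0, smul_zero]

/-- Every monomial `x^c` of `T_1 ⋯ T_i x^a` satisfies `c + 1 ≤ a` in dominance, so each application
raises the lower bound on `a` by one full column. -/
theorem dominated_of_comp_rationalDunkl (α : K) {i : ℕ} (ψ : MvPolynomial (Fin i) K →ₗ[K] K)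
    {b : Fin i → ℕ} (hψ : ∀ a, ψ (monomial a 1) ≠ 0 → Dominated b a) (k : ℕ) (a : Fin i →₀ ℕ)
    (ha : (ψ ∘ₗ (opProd (fun _ => rationalDunkl α) id :
      Module.End K (MvPolynomial (Fin i) K)) ^ k) (monomial a 1) ≠ 0) :
    Dominated (fun j => b j + k) a := by
  induction k generalizing a with
  | zero => exact hψ a ha
  | succ k ih =>
    rw [pow_succ, Module.End.mul_eq_comp, ← LinearMap.comp_assoc, LinearMap.comp_apply] at ha
    obtain ⟨c, hc, hψc⟩ := exists_coeff_of_linearMap_ne_zero _ ha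
    obtain ⟨a', ha', hdom⟩ :=
      dominated_of_coeff_opProd_rationalDunkl α id Function.injective_id hc
    have haa : a = a' := by
      by_contra hne
      exact ha' (by rw [coeff_monomial, if_neg hne])
    subst haa
    refine Dominated.trans ?_ hdom
    have h1 := dominated_add_indicator (ih c hψc) Finset.univ (by simp)
    refine Dominated.trans ?_ (Dominated.trans h1 ?_)
    · exact dominated_of_le fun s => by simp [indicator, add_assoc]
    · exact dominated_of_le fun s => by simp [indicator]

theorem killLast_monomial_ne_zero {i : ℕ} {a : Fin (i + 1) →₀ ℕ}
    {ψ : MvPolynomial (Fin i) K →ₗ[K] K} (h : ψ (killLast K i (monomial a 1)) ≠ 0) :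
    ∃ c : Fin i →₀ ℕ, ψ (monomial c 1) ≠ 0 ∧ Dominated c a := by
  refine ⟨a.comapDomain Fin.castSucc (Fin.castSucc_injective i).injOn, ?_,
    dominated_comp a (Fin.castSucc_injective i)⟩
  have h0 : a (Fin.last i) = 0 := by
    by_contra hne
    apply h
    rw [killLast, killCompl, aeval_monomial, Finsupp.prod, Finset.prod_eq_zero (i := Fin.last i),
      mul_zero, map_zero]
    · simpa using hne
    · rw [dif_neg, zero_pow hne]
      rintro ⟨j, hj⟩
      exact (Fin.castSucc_lt_last j).ne hj
  have ha : a = (a.comapDomain Fin.castSucc (Fin.castSucc_injective i).injOn).mapDomain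
      Fin.castSucc := by
    rw [Finsupp.mapDomain_comapDomain _ (Fin.castSucc_injective i)]
    intro s hs
    by_contra hne
    have : s = Fin.last i := by
      by_contra hne'
      exact hne ⟨s.castPred hne', Fin.castSucc_castPred s hne'⟩
    rw [this] at hs
    simp [h0] at hs
  rwa [ha, ← rename_monomial, killLast, killCompl_rename_app] at h

theorem dominated_of_jackFunctional (α : K) (d : ℕ → ℕ) (i : ℕ) (a : Fin i →₀ ℕ)
    (ha : jackFunctional α d i (monomial a 1) ≠ 0) : Dominated (columnParts d i) a := by
  induction i with
  | zero =>
    intro S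
    exact ⟨∅, by simp, by simp [Subsingleton.elim S ∅]⟩
  | succ i ih =>
    have h := dominated_of_comp_rationalDunkl α
      (jackFunctional α d i ∘ₗ (killLast K i).toLinearMap)
      (b := fun j => ∑ k ∈ Finset.Ico (j : ℕ) i, d (k + 1)) ?_ (d (i + 1)) a ha
    · exact Dominated.trans (dominated_of_le fun j => (columnParts_succ d i j).le) h
    · intro a ha
      obtain ⟨c, hc, hdom⟩ := killLast_monomial_ne_zero (ψ := jackFunctional α d i) ha
      exact ((dominated_columnParts_iff d i).1.trans (ih c hc)).trans hdom

/-- The exponent of `∏_{j ∈ J} x_j`. -/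
def indicatorExp {n : ℕ} (J : Finset (Fin n)) : Fin n →₀ ℕ :=
  Finsupp.equivFunOnFinite.symm (indicator J)

theorem indicatorExp_apply {n : ℕ} (J : Finset (Fin n)) (k : Fin n) :
    indicatorExp J k = if k ∈ J then 1 else 0 :=
  rfl

theorem prod_X_eq_monomial {n : ℕ} (J : Finset (Fin n)) :
    (∏ j ∈ J, X j : MvPolynomial (Fin n) K) = monomial (indicatorExp J) 1 := by
  have h : indicatorExp J = ∑ j ∈ J, Finsupp.single j 1 := by
    ext k
    rw [indicatorExp_apply, Finsupp.finsetSum_apply]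
    simp [Finsupp.single_apply]
  rw [h, monomial_sum_one]
  rfl

theorem coeff_creation (α : K) (n i : ℕ) (f : MvPolynomial (Fin n) K) (c : Fin n →₀ ℕ) :
    coeff c (creation α n i f) = ∑ J ∈ Finset.powersetCard i Finset.univ,
      if indicatorExp J ≤ c then coeff (c - indicatorExp J) (dunklProd α J f) else 0 := by
  rw [creation, LinearMap.sum_apply, coeff_sum]
  refine Finset.sum_congr rfl fun J _ => ?_
  rw [Module.End.mul_apply, mulBy, LinearMap.mulLeft_apply, prod_X_eq_monomial,
    coeff_monomial_mul', one_mul]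

/-- `D_J` does not raise dominance, and `x_J` adds `i` units at distinct places, at most a column on
the `i` rows of `b`. -/
theorem dominated_of_coeff_creation (α : K) {n i : ℕ} {f : MvPolynomial (Fin n) K}
    {b : Fin i → ℕ} (hf : ∀ c, coeff c f ≠ 0 → Dominated c b) (c : Fin n →₀ ℕ)
    (hc : coeff c (creation α n i f) ≠ 0) : Dominated c (b + 1) := by
  rw [coeff_creation] at hc
  obtain ⟨J, hJ, hne⟩ := Finset.exists_ne_zero_of_sum_ne_zero hc
  split_ifs at hne with hle
  · rw [dunklProd_eq] at hne
    obtain ⟨c', hc', hdom⟩ := dominated_of_coeff_opProd_dunkl α _ (fun s => s + 1) hne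
    have h := dominated_add_indicator (hdom.trans (hf c' hc')) J
      (by rw [(Finset.mem_powersetCard.1 hJ).2, Fintype.card_fin])
    refine Dominated.trans (dominated_of_le fun s => ?_) h
    have := hle s
    rw [indicatorExp_apply] at this
    simp only [Pi.add_apply, Finsupp.coe_tsub, Pi.sub_apply, indicatorExp_apply, indicator]
    omega
  · exact absurd rfl hne

theorem dominated_of_coeff_creation_pow (α : K) {n i : ℕ} {f : MvPolynomial (Fin n) K}
    {b : Fin i → ℕ} (hf : ∀ c, coeff c f ≠ 0 → Dominated c b) (k : ℕ) (c : Fin n →₀ ℕ)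
    (hc : coeff c ((creation α n i ^ k) f) ≠ 0) : Dominated c (fun j => b j + k) := by
  induction k generalizing c with
  | zero => exact hf c hc
  | succ k ih =>
    rw [pow_succ', Module.End.mul_apply] at hc
    exact dominated_of_coeff_creation α ih c hc

theorem dominated_of_coeff_jackFun [CharZero K] {α : K} (hα : α ≠ 0) (d : ℕ → ℕ) (n i : ℕ)
    (c : Fin n →₀ ℕ) (hc : coeff c (toVars n (jackFun α d i)) ≠ 0) :
    Dominated c (columnParts d i) := by
  induction i generalizing c with
  | zero =>
    rw [toVars_jackFun_zero, coeff_one] at hc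
    have h0 : c = 0 := by
      by_contra hne
      exact hc (if_neg (Ne.symm hne))
    intro S
    exact ⟨∅, by simp, by simp [h0]⟩
  | succ i ih =>
    rw [toVars_jackFun_succ hα] at hc
    refine Dominated.trans (dominated_of_coeff_creation_pow α (fun c hc =>
      (ih c hc).trans (dominated_columnParts_iff d i).2) _ c hc) ?_
    exact dominated_of_le fun j => (columnParts_succ d i j).ge

/-- The product is the functional of the first function evaluated on the second. Some monomial `x^a`
of the second is therefore not killed, and its exponent lies between the two partitions. -/
theorem dominated_of_scalarProduct_jackFun [CharZero K] {α : K} (hα : α ≠ 0) (d d' : ℕ → ℕ)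
    (i i' : ℕ) (h : scalarProduct α (jackFun α d i) (jackFun α d' i') ≠ 0) :
    Dominated (columnParts d i) (columnParts d' i') := by
  have hN : columnSize d i = columnSize d' i' := by
    by_contra hne
    exact h (scalarProduct_jackFun_of_ne α d d' i i' hne)
  rw [jackFun, scalarProduct_dualFun hα i _ _ fun m hm => (size_of_coeff_jackFun hm).trans hN.symm]
    at h
  obtain ⟨a, ha, hψ⟩ := exists_coeff_of_linearMap_ne_zero _ h
  exact (dominated_of_jackFunctional α d i a hψ).trans (dominated_of_coeff_jackFun hα d' i i' a ha)

/-! The normalization -/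

/-- A term `J ⊆ S` contributes the coefficient of `D_J f` at `S \ J`. No index of `J` occurs there,
so only the shifts act, giving `i! N!`. There are `(N + i).choose i` such `J`. -/
theorem coeff_indicatorExp_creation (α : K) {n i N : ℕ} {f : MvPolynomial (Fin n) K}
    (hf : ∀ S : Finset (Fin n), S.card = N → coeff (indicatorExp S) f = (N.factorial : K))
    (S : Finset (Fin n)) (hS : S.card = N + i) :
    coeff (indicatorExp S) (creation α n i f) = ((N + i).factorial : K) := by
  have hterm : ∀ J ∈ Finset.powersetCard i (Finset.univ : Finset (Fin n)),
      (if indicatorExp J ≤ indicatorExp S then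
        coeff (indicatorExp S - indicatorExp J) (dunklProd α J f) else 0) =
      if J ⊆ S then ((i.factorial * N.factorial : ℕ) : K) else 0 := by
    intro J hJ
    have hcard := (Finset.mem_powersetCard.1 hJ).2
    have hiff : indicatorExp J ≤ indicatorExp S ↔ J ⊆ S := by
      constructor
      · intro h k hk
        have := h k
        rw [indicatorExp_apply, indicatorExp_apply, if_pos hk] at this
        by_contra hkS
        rw [if_neg hkS] at this
        omega
      · intro h k
        rw [indicatorExp_apply, indicatorExp_apply]
        split_ifs with h1 h2
        · exact le_rfl
        · exact absurd (h h1) h2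
        · exact Nat.zero_le _
        · exact le_rfl
    simp only [hiff]
    split_ifs with hJS
    · have hsub : indicatorExp S - indicatorExp J = indicatorExp (S \ J) := by
        ext k
        rw [Finsupp.tsub_apply, indicatorExp_apply, indicatorExp_apply, indicatorExp_apply]
        simp only [Finset.mem_sdiff]
        by_cases hk : k ∈ J
        · simp [hk, hJS hk]
        · simp [hk]
      have hN : (S \ J).card = N := by
        rw [Finset.card_sdiff_of_subset hJS, hS, hcard]
        omega
      rw [hsub, dunklProd_eq, coeff_opProd_dunkl α _ (fun s => s + 1), hf _ hN,
        Finset.prod_range_add_one_eq_factorial, hcard]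
      · push_cast
        ring
      · intro s
        rw [indicatorExp_apply, if_neg]
        rw [Finset.mem_sdiff, not_and, not_not]
        exact fun _ => Finset.orderEmbOfFin_mem J rfl s
    · rfl
  rw [coeff_creation, Finset.sum_congr rfl hterm, ← Finset.sum_filter, Finset.sum_const]
  have hfilter : (Finset.powersetCard i (Finset.univ : Finset (Fin n))).filter (· ⊆ S) =
      Finset.powersetCard i S := by
    ext J
    simp [Finset.mem_powersetCard, and_comm]
  rw [hfilter, Finset.card_powersetCard, hS, nsmul_eq_mul, ← Nat.cast_mul]
  congr 1
  have h := Nat.choose_mul_factorial_mul_factorial (Nat.le_add_left i N)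
  rw [Nat.add_sub_cancel] at h
  rw [← h, mul_assoc]

theorem coeff_indicatorExp_jackFun [CharZero K] {α : K} (hα : α ≠ 0) (d : ℕ → ℕ) (n i : ℕ)
    (S : Finset (Fin n)) (hS : S.card = columnSize d i) :
    coeff (indicatorExp S) (toVars n (jackFun α d i)) = ((columnSize d i).factorial : K) := by
  have hpow : ∀ (k i N : ℕ) (f : MvPolynomial (Fin n) K),
      (∀ S : Finset (Fin n), S.card = N → coeff (indicatorExp S) f = (N.factorial : K)) →
      ∀ S : Finset (Fin n), S.card = N + i * k →
        coeff (indicatorExp S) ((creation α n i ^ k) f) = ((N + i * k).factorial : K) := by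
    intro k i N f hf
    induction k with
    | zero => exact hf
    | succ k ih =>
      rw [pow_succ', mul_add, mul_one, ← add_assoc]
      exact coeff_indicatorExp_creation α ih
  induction i generalizing S with
  | zero =>
    have hS0 : S = ∅ := by simpa [columnSize] using hS
    have h0 : indicatorExp (∅ : Finset (Fin n)) = 0 := by
      ext k
      simp [indicatorExp_apply]
    rw [toVars_jackFun_zero, hS0, h0]
    simp [columnSize]
  | succ i ih =>
    have hsize : columnSize d (i + 1) = columnSize d i + (i + 1) * d (i + 1) :=
      Finset.sum_range_succ _ _
    rw [hsize] at hS ⊢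
    rw [toVars_jackFun_succ hα]
    exact hpow _ _ _ _ ih S hS

end

end JackRodrigues

end

noncomputable section

namespace JackRodrigues

open MvPolynomial

/-! The scalar product is anisotropic -/

/-- At each rational `t > 0` all terms are nonnegative, so each `P m` vanishes at infinitely many
points. -/
theorem eq_zero_of_sum_sq_mul_X_pow {ι : Type*} (s : Finset ι) (c : ι → ℚ) (hc : ∀ m ∈ s, 0 < c m)
    (e : ι → ℕ) (P : ι → Polynomial ℚ)
    (h : ∑ m ∈ s, Polynomial.C (c m) * P m ^ 2 * Polynomial.X ^ e m = 0) :
    ∀ m ∈ s, P m = 0 := by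
  intro m hm
  refine Polynomial.eq_zero_of_infinite_isRoot _ ((Set.Ioi_infinite (0 : ℚ)).mono fun t ht => ?_)
  have ht' : 0 < t := ht
  have h1 := congrArg (Polynomial.eval t) h
  simp only [Polynomial.eval_finsetSum, Polynomial.eval_mul, Polynomial.eval_C,
    Polynomial.eval_pow, Polynomial.eval_X, Polynomial.eval_zero] at h1
  rw [Finset.sum_eq_zero_iff_of_nonneg fun k hk =>
    mul_nonneg (mul_nonneg (hc k hk).le (sq_nonneg _)) (pow_nonneg ht'.le _)] at h1
  have h2 := h1 m hm
  have h3 := (hc m hm).ne'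
  have h4 := (pow_pos ht' (e m)).ne'
  simpa [h3, ht'.ne'] using h2

theorem eq_zero_of_scalarProduct_self {f : SymFun (RatFunc ℚ)}
    (h : scalarProduct (RatFunc.X : RatFunc ℚ) f f = 0) : f = 0 := by
  -- A common denominator reduces the claim to polynomials in `α`, where positivity is available.
  obtain ⟨b, hb⟩ := IsLocalization.exist_integer_multiples (nonZeroDivisors (Polynomial ℚ))
    f.support fun m => coeff m f
  choose! P hP using hb
  have hb0 : algebraMap (Polynomial ℚ) (RatFunc ℚ) b ≠ 0 :=
    IsFractionRing.to_map_ne_zero_of_mem_nonZeroDivisors b.2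
  have hP' : ∀ m ∈ f.support,
      algebraMap (Polynomial ℚ) (RatFunc ℚ) (P m) = algebraMap _ _ (b : Polynomial ℚ) * coeff m f :=
    fun m hm => by rw [hP m hm, Algebra.smul_def]
  have key : ∑ m ∈ f.support,
      Polynomial.C (zed m : ℚ) * P m ^ 2 * Polynomial.X ^ m.degree = 0 := by
    apply IsFractionRing.injective (Polynomial ℚ) (RatFunc ℚ)
    rw [map_zero, map_sum, ← mul_zero (algebraMap (Polynomial ℚ) (RatFunc ℚ) b ^ 2), ← h,
      scalarProduct, Finset.mul_sum]
    refine Finset.sum_congr rfl fun m hm => ?_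
    rw [map_mul, map_mul, map_pow, map_pow, hP' m hm, RatFunc.algebraMap_X, map_natCast,
      map_natCast]
    ring
  have h0 := eq_zero_of_sum_sq_mul_X_pow f.support (fun m => (zed m : ℚ))
    (fun m _ => by exact_mod_cast Nat.pos_of_ne_zero (zed_ne_zero m)) _ P key
  ext m
  rw [coeff_zero]
  by_contra hne
  have hm : m ∈ f.support := mem_support_iff.2 hne
  have h1 := hP' m hm
  rw [h0 m hm, map_zero] at h1
  exact mul_ne_zero hb0 hne h1.symm

/-! A symmetric function is determined by its restrictions to finitely many variables -/

section

variable {K : Type*} [Field K]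

theorem pderiv_toVars (n : ℕ) (a : Fin n) (f : SymFun K) {s : Finset ℕ+} (hs : f.vars ⊆ s) :
    pderiv a (toVars n f) =
      ∑ r ∈ s, toVars n (pderiv r f) * pderiv a (psum (Fin n) K r) := by
  have hm : ∀ m ∈ f.support, pderiv a (toVars n (monomial m (coeff m f))) =
      ∑ r ∈ s, toVars n (pderiv r (monomial m (coeff m f))) * pderiv a (psum (Fin n) K r) := by
    intro m hm
    have h : monomial m (coeff m f) = coeff m f • monomial m (1 : K) := by
      rw [smul_monomial, smul_eq_mul, mul_one]
    rw [h, map_smul, Derivation.map_smul, pderiv_toVars_monomial n a m s fun r hr =>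
      hs ((mem_vars_iff_mem_support r).2 ⟨m, hm, hr⟩), Finset.smul_sum]
    exact Finset.sum_congr rfl fun r _ => by rw [Derivation.map_smul, map_smul, smul_mul_assoc]
  conv_lhs => rw [f.as_sum, map_sum, map_sum, Finset.sum_congr rfl hm, Finset.sum_comm]
  refine Finset.sum_congr rfl fun r _ => ?_
  rw [← Finset.sum_mul, ← map_sum, ← map_sum, ← f.as_sum]

/-- Differentiating `f(x) = 0` in each `x_a` gives `∑_r r x_a^{r-1} (∂f/∂p_r)(x) = 0`. With at least
as many variables as power sums in play, this Vandermonde system forces every coefficient to vanish.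
-/
theorem toVars_pderiv_eq_zero [CharZero K] {f : SymFun K} (hf : ∀ n, toVars n f = 0) (r : ℕ+)
    (n : ℕ) : toVars n (pderiv r f) = 0 := by
  classical
  obtain ⟨M, hM⟩ : ∃ M : ℕ, ∀ k ∈ insert r f.vars, (k : ℕ) ≤ M :=
    ⟨(insert r f.vars).sup fun k => (k : ℕ), fun k hk =>
      Finset.le_sup (f := fun k : ℕ+ => (k : ℕ)) hk⟩
  -- Enough variables for the Vandermonde argument, and at least `n`, so that the extra ones can be
  -- set to zero at the end.
  set n' := max n M with hn'
  have hs : f.vars ⊆ Finset.univ.image fun j : Fin n' => Nat.succPNat j := by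
    intro k hk
    have h1 := hM k (Finset.mem_insert_of_mem hk)
    have h2 := k.pos
    exact Finset.mem_image.2 ⟨⟨k - 1, by omega⟩, Finset.mem_univ _, by
      rw [← PNat.coe_inj]; simp only [Nat.succPNat_coe]; omega⟩
  have hinj : Function.Injective fun j : Fin n' => Nat.succPNat j := fun j k h => by
    simpa [Fin.ext_iff] using h
  have hv := Matrix.eq_zero_of_forall_index_sum_mul_pow_eq_zero
    (f := fun a : Fin n' => (X a : MvPolynomial (Fin n') K))
    (v := fun j : Fin n' => ((j + 1 : ℕ) : K) • toVars n' (pderiv (Nat.succPNat j) f))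
    (X_injective) (fun a => by
      have h := pderiv_toVars n' a f hs
      rw [hf, map_zero, Finset.sum_image hinj.injOn] at h
      rw [h]
      refine Finset.sum_congr rfl fun j _ => ?_
      rw [pderiv_psum, Nat.succPNat_coe, Nat.succ_eq_add_one, Nat.add_sub_cancel,
        mul_smul_comm, smul_mul_assoc])
  have h1 := hM r (Finset.mem_insert_self _ _)
  have h2 := r.pos
  have h3 := congrFun hv ⟨r - 1, by omega⟩
  have h4 : Nat.succPNat ((r : ℕ) - 1) = r := by
    rw [← PNat.coe_inj]; simp only [Nat.succPNat_coe]; omega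
  simp only [h4, Pi.zero_apply] at h3
  have h5 := (smul_eq_zero.1 h3).resolve_left (by norm_cast)
  rw [← killCompl_toVars (Fin.castLE_injective (le_max_left n M)) (pderiv r f)]
  exact (congrArg _ h5).trans (map_zero _)

theorem coeff_zero_of_toVars {f : SymFun K} (hf : toVars 0 f = 0) : coeff 0 f = 0 := by
  have h : (toVars 0 : SymFun K →ₐ[K] _) = (Algebra.ofId K _).comp (aeval fun _ => (0 : K)) := by
    apply algHom_ext
    intro r
    simp [toVars_X, psum]
  rw [h, AlgHom.comp_apply, Algebra.ofId_apply] at hf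
  have h1 := (C_injective (Fin 0) K) (hf.trans C_0.symm)
  simpa [aeval_zero', constantCoeff_eq] using h1

/-- The partial derivatives in the power sums inherit the hypothesis. In characteristic zero they
recover each coefficient from one of smaller degree, down to the constant term. -/
theorem eq_zero_of_toVars [CharZero K] {f : SymFun K} (hf : ∀ n, toVars n f = 0) : f = 0 := by
  suffices H : ∀ (d : ℕ) (g : SymFun K), (∀ n, toVars n g = 0) →
      ∀ m : ℕ+ →₀ ℕ, m.degree = d → coeff m g = 0 by
    ext m
    rw [coeff_zero]
    exact H m.degree f hf m rfl
  intro d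
  induction d with
  | zero =>
    intro g hg m hm
    rw [(Finsupp.degree_eq_zero_iff m).1 hm]
    exact coeff_zero_of_toVars (hg 0)
  | succ d ih =>
    intro g hg m hm
    have hm0 : m ≠ 0 := by
      rintro rfl
      simp at hm
    obtain ⟨r, hr⟩ := Finsupp.ne_iff.1 hm0
    have hle : Finsupp.single r 1 ≤ m := by
      rw [Finsupp.single_le_iff]
      exact Nat.one_le_iff_ne_zero.2 hr
    have hdeg : (m - Finsupp.single r 1).degree = d := by
      rw [← tsub_add_cancel_of_le hle, map_add, Finsupp.degree_single] at hm
      exact Nat.succ_injective hm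
    have h := ih (pderiv r g) (toVars_pderiv_eq_zero hg r) _ hdeg
    rw [coeff_pderiv, tsub_add_cancel_of_le hle] at h
    refine (mul_eq_zero.1 h).resolve_right ?_
    norm_cast

end

end JackRodrigues

end

noncomputable section

namespace JackRodrigues

open MvPolynomial

/-! Triangular orthogonal bases -/

section

variable {K V ι : Type*} [Field K] [AddCommGroup V] [Module K V] [PartialOrder ι]

/-- An orthogonal family for `B` that is triangular with respect to a coordinate expansion with
graph `W`, and normalized by a nonzero coordinate. -/
structure IsTriangular (B : V →ₗ[K] V →ₗ[K] K) (W : Submodule K (V × (ι → K))) (o : ι) (c : K)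
    (J : ι → V) (v : ι → ι → K) : Prop where
  orthogonal : ∀ i j, i ≠ j → B (J i) (J j) = 0
  mem : ∀ i, (J i, v i) ∈ W
  le : ∀ i j, v i j ≠ 0 → j ≤ i
  normalized : ∀ i, v i o = c

variable {B : V →ₗ[K] V →ₗ[K] K} {W : Submodule K (V × (ι → K))} {o : ι} {c : K}
  {J : ι → V} {v : ι → ι → K}

/-- Elimination: a multiple of `J i`, for `i` maximal in the lower set `D`, clears the coordinate
`i`, and what remains is supported on `D.erase i`, again a lower set. -/
theorem IsTriangular.mem_span (h : IsTriangular B W o c J v) (hW : ∀ f, (f, 0) ∈ W → f = 0)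
    (D : Finset ι) (hD : ∀ i ∈ D, ∀ j ≤ i, j ∈ D) (hv : ∀ i ∈ D, v i i ≠ 0) :
    ∀ (f : V) (w : ι → K), (f, w) ∈ W → (∀ i, w i ≠ 0 → i ∈ D) →
      f ∈ Submodule.span K (J '' D) := by
  classical
  induction hn : D.card generalizing D with
  | zero =>
    intro f w hf hw
    have hw0 : w = 0 := by
      ext i
      by_contra hi
      have := hw i hi
      rw [Finset.card_eq_zero.1 hn] at this
      exact absurd this (Finset.notMem_empty i)
    rw [hW f (hw0 ▸ hf)]
    exact Submodule.zero_mem _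
  | succ n ih =>
    intro f w hf hw
    obtain ⟨i, hi⟩ := D.exists_maximal (Finset.card_pos.1 (by omega))
    have hiD := hi.prop
    have hgW := W.sub_mem hf (W.smul_mem (w i / v i i) (h.mem i))
    have hg := ih (D.erase i)
      (fun k hk j hj => Finset.mem_erase.2 ⟨by
        rintro rfl
        exact (Finset.mem_erase.1 hk).1 (le_antisymm (hi.2 (Finset.mem_of_mem_erase hk) hj) hj),
        hD k (Finset.mem_of_mem_erase hk) j hj⟩)
      (fun k hk => hv k (Finset.mem_of_mem_erase hk))
      (by rw [Finset.card_erase_of_mem hiD, hn, Nat.add_sub_cancel]) _ _ hgW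
      (fun k hk => by
        have hki : k ≠ i := by
          rintro rfl
          apply hk
          have := hv k hiD
          simp only [Prod.smul_snd, Pi.sub_apply, Pi.smul_apply, smul_eq_mul]
          field_simp
          ring
        refine Finset.mem_erase.2 ⟨hki, ?_⟩
        by_contra hkD
        apply hk
        have h1 : w k = 0 := by_contra fun h1 => hkD (hw k h1)
        have h2 : v i k = 0 := by_contra fun h2 => hkD (hD i hiD k (h.le i k h2))
        simp [h1, h2])
    have h1 : f = (f - (w i / v i i) • J i) + (w i / v i i) • J i := (sub_add_cancel _ _).symm
    rw [h1]
    refine Submodule.add_mem _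
      (Submodule.span_mono (Set.image_mono (Finset.coe_subset.2 (Finset.erase_subset i D))) hg) ?_
    exact Submodule.smul_mem _ _ (Submodule.subset_span ⟨i, hiD, rfl⟩)

theorem IsTriangular.apply_eq_zero (h : IsTriangular B W o c J v) {D : Set ι} {i : ι} (hi : i ∉ D)
    {f : V} (hf : f ∈ Submodule.span K (J '' D)) : B f (J i) = 0 := by
  induction hf using Submodule.span_induction with
  | mem x hx =>
    obtain ⟨j, hj, rfl⟩ := hx
    exact h.orthogonal j i fun e => hi (e ▸ hj)
  | zero => simp
  | add x y _ _ hx hy => simp [hx, hy]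
  | smul a x _ hx => simp [hx]

/-- Otherwise `J i` would lie in the span of the lower members, hence be orthogonal to itself and
vanish, against the normalization. -/
theorem IsTriangular.diag_ne_zero [Finite ι] (h : IsTriangular B W o c J v) (hW : ∀ f, (f, 0) ∈ W → f = 0)
    (hW' : ∀ w, (0, w) ∈ W → w o = 0) (hB : ∀ f, B f f = 0 → f = 0) (hc : c ≠ 0) (i : ι) :
    v i i ≠ 0 := by
  classical
  have := Fintype.ofFinite ι
  induction i using WellFoundedLT.induction with
  | ind i ih =>
    intro h0
    have hspan := h.mem_span hW (Finset.univ.filter (· < i))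
      (fun k hk j hj => by
        rw [Finset.mem_filter] at hk ⊢
        exact ⟨Finset.mem_univ _, hj.trans_lt hk.2⟩)
      (fun k hk => ih k (Finset.mem_filter.1 hk).2) (J i) (v i) (h.mem i)
      (fun k hk => Finset.mem_filter.2 ⟨Finset.mem_univ _, lt_of_le_of_ne (h.le i k hk) (by
        rintro rfl
        exact hk h0)⟩)
    have hJ : J i = 0 := hB _ (h.apply_eq_zero (by simp) hspan)
    have h1 := hW' (v i) (hJ ▸ h.mem i)
    rw [h.normalized] at h1
    exact hc h1

/-- The combination `u_ii J_i - v_ii R_i` has no coordinate at `i`, so it lies in the span of the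
lower members of either family. It is thus orthogonal to `J_i` and to `R_i`, hence to itself, and
vanishes. -/
theorem IsTriangular.unique [Finite ι] (h : IsTriangular B W o c J v) {R : ι → V} {u : ι → ι → K}
    (h' : IsTriangular B W o c R u) (hW : ∀ f, (f, 0) ∈ W → f = 0)
    (hW' : ∀ w, (0, w) ∈ W → w o = 0) (hB : ∀ f, B f f = 0 → f = 0) (hc : c ≠ 0) : J = R := by
  classical
  have := Fintype.ofFinite ι
  have hv := h.diag_ne_zero hW hW' hB hc
  have hu := h'.diag_ne_zero hW hW' hB hc
  funext i
  have hmem := W.sub_mem (W.smul_mem (u i i) (h.mem i)) (W.smul_mem (v i i) (h'.mem i))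
  have hsupp : ∀ k, (u i i • v i - v i i • u i) k ≠ 0 → k ∈ Finset.univ.filter (· < i) := by
    intro k hk
    refine Finset.mem_filter.2 ⟨Finset.mem_univ _, lt_of_le_of_ne ?_ ?_⟩
    · by_contra hki
      have h1 : v i k = 0 := by_contra fun h1 => hki (h.le i k h1)
      have h2 : u i k = 0 := by_contra fun h2 => hki (h'.le i k h2)
      simp [h1, h2] at hk
    · rintro rfl
      apply hk
      simp only [Pi.sub_apply, Pi.smul_apply, smul_eq_mul]
      ring
  have hlow : ∀ k ∈ Finset.univ.filter (· < i), ∀ j ≤ k, j ∈ Finset.univ.filter (· < i) :=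
    fun k hk j hj => by
      rw [Finset.mem_filter] at hk ⊢
      exact ⟨Finset.mem_univ _, hj.trans_lt hk.2⟩
  have h1 := h.mem_span hW _ hlow (fun k _ => hv k) _ _ hmem hsupp
  have h2 := h'.mem_span hW _ hlow (fun k _ => hu k) _ _ hmem hsupp
  have h3 := h.apply_eq_zero (i := i) (by simp) h1
  have h4 := h'.apply_eq_zero (i := i) (by simp) h2
  have h0 : u i i • J i - v i i • R i = 0 := by
    apply hB
    rw [map_sub (B _), map_smul (B _), map_smul (B _)]
    exact (congrArg₂ (fun a b => u i i • a - v i i • b) h3 h4).trans (by simp)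
  -- The normalized coordinate of the vanishing combination is `c (u_ii - v_ii)`, so the two
  -- diagonal entries agree.
  have h5 := hW' (u i i • v i - v i i • u i) (by
    have h6 := hmem
    rw [Prod.smul_mk, Prod.smul_mk, Prod.mk_sub_mk, h0] at h6
    exact h6)
  simp only [Pi.sub_apply, Pi.smul_apply, smul_eq_mul, h.normalized, h'.normalized] at h5
  rw [← sub_mul] at h5
  rw [sub_eq_zero.1 ((mul_eq_zero.1 h5).resolve_right hc), ← smul_sub] at h0
  exact sub_eq_zero.1 ((smul_eq_zero.1 h0).resolve_left (hv i))

end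

end JackRodrigues

end

noncomputable section

namespace JackRodrigues

open MvPolynomial

/-! The rows of a partition -/

section

variable {N : ℕ}

/-- The rows of a partition in decreasing order, continued by zeros. -/
def row (μ : N.Partition) (j : ℕ) : ℕ := (μ.parts.sort (· ≥ ·)).getD j 0

theorem sum_range_getD (L : List ℕ) (i : ℕ) :
    ∑ j ∈ Finset.range i, L.getD j 0 = (L.take i).sum := by
  induction L generalizing i with
  | nil => simp
  | cons x L ih =>
    cases i with
    | zero => simp
    | succ i =>
      rw [Finset.sum_range_succ', List.take_succ_cons, List.sum_cons, ← ih, add_comm]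
      simp

theorem dominatedBy_iff {μ ν : N.Partition} : DominatedBy μ ν ↔
    ∀ i, ∑ j ∈ Finset.range i, row μ j ≤ ∑ j ∈ Finset.range i, row ν j := by
  simp only [DominatedBy, row, sum_range_getD]

theorem card_parts_le (μ : N.Partition) : μ.parts.card ≤ N := by
  conv_rhs => rw [← μ.parts_sum]
  have := Multiset.card_nsmul_le_sum (s := μ.parts) (a := 1) fun x hx => μ.parts_pos hx
  simpa using this

theorem length_sort_parts (μ : N.Partition) :
    (μ.parts.sort (· ≥ ·)).length = μ.parts.card := Multiset.length_sort _

theorem row_eq_zero (μ : N.Partition) {j : ℕ} (hj : N ≤ j) : row μ j = 0 := by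
  have h1 := card_parts_le μ
  rw [row, List.getD_eq_default _ _ (by rw [length_sort_parts]; omega)]

theorem row_ne_zero_iff (μ : N.Partition) {j : ℕ} : row μ j ≠ 0 ↔ j < μ.parts.card := by
  rw [← length_sort_parts, row]
  constructor
  · intro h
    by_contra hj
    exact h (List.getD_eq_default _ _ (not_lt.1 hj))
  · intro h
    rw [List.getD_eq_getElem _ _ h]
    exact (μ.parts_pos ((Multiset.mem_sort (· ≥ ·)).1 (List.getElem_mem h))).ne'

theorem row_antitone (μ : N.Partition) : Antitone (row μ) := by
  intro i j hij
  rcases lt_or_ge j (μ.parts.sort (· ≥ ·)).length with hj | hj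
  · rw [row, row, List.getD_eq_getElem _ _ hj, List.getD_eq_getElem _ _ (hij.trans_lt hj)]
    exact (Multiset.pairwise_sort μ.parts (· ≥ ·)).rel_get_of_le (a := ⟨i, hij.trans_lt hj⟩)
      (b := ⟨j, hj⟩) hij
  · rw [row, row, List.getD_eq_default _ _ hj]
    exact Nat.zero_le _

theorem sum_row (μ : N.Partition) {i : ℕ} (hi : N ≤ i) : ∑ j ∈ Finset.range i, row μ j = N := by
  have h1 := card_parts_le μ
  conv_rhs => rw [← μ.parts_sum, ← Multiset.sort_eq μ.parts (· ≥ ·), Multiset.sum_coe]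
  simp only [row]
  rw [sum_range_getD, List.take_of_length_le (by rw [length_sort_parts]; omega)]

theorem row_injective : Function.Injective (row : N.Partition → ℕ → ℕ) := by
  intro μ ν h
  have hc : μ.parts.card = ν.parts.card := by
    apply le_antisymm
    all_goals
      by_contra! hlt
    · exact absurd ((row_ne_zero_iff μ).2 hlt) (by rw [h, row_ne_zero_iff]; omega)
    · exact absurd ((row_ne_zero_iff ν).2 hlt) (by rw [← h, row_ne_zero_iff]; omega)
  apply Nat.Partition.ext
  rw [← Multiset.sort_eq μ.parts (· ≥ ·), ← Multiset.sort_eq ν.parts (· ≥ ·)]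
  congr 1
  refine List.ext_getElem (by rw [length_sort_parts, length_sort_parts, hc]) fun j h1 h2 => ?_
  have h3 := congrFun h j
  rwa [row, row, List.getD_eq_getElem _ _ h1, List.getD_eq_getElem _ _ h2] at h3

theorem getD_filter_ne_zero {L : List ℕ} (hL : L.Pairwise (· ≥ ·)) (j : ℕ) :
    (L.filter (· ≠ 0)).getD j 0 = L.getD j 0 := by
  induction L generalizing j with
  | nil => rfl
  | cons x L ih =>
    rw [List.pairwise_cons] at hL
    rcases eq_or_ne x 0 with rfl | hx
    · have h0 : ∀ y ∈ (0 : ℕ) :: L, y = 0 := by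
        intro y hy
        rcases List.mem_cons.1 hy with rfl | hy
        · rfl
        · exact Nat.le_zero.1 (hL.1 y hy)
      rw [List.filter_eq_nil_iff.2 fun y hy => by simp [h0 y hy], List.getD_nil]
      rcases lt_or_ge j (0 :: L).length with hj | hj
      · rw [List.getD_eq_getElem _ _ hj]
        exact (h0 _ (List.getElem_mem hj)).symm
      · rw [List.getD_eq_default _ _ hj]
    · rw [List.filter_cons_of_pos (by simpa using hx)]
      cases j with
      | zero => simp
      | succ j => simpa using ih hL.2 j

/-- The rows of a partition given by a decreasing sequence. -/
theorem row_eq_of_parts_eq {n : ℕ} {r : Fin n → ℕ} (hr : Antitone r) {μ : N.Partition}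
    (h : μ.parts = (Finset.univ.val.map r).filter (· ≠ 0)) (j : ℕ) :
    row μ j = if hj : j < n then r ⟨j, hj⟩ else 0 := by
  have hpw : (List.ofFn r).Pairwise (· ≥ ·) := by
    rw [List.pairwise_ofFn]
    exact fun i j hij => hr hij.le
  have hs : μ.parts.sort (· ≥ ·) = (List.ofFn r).filter (· ≠ 0) := by
    have h1 : μ.parts = ((List.ofFn r).filter (· ≠ 0) : List ℕ) := by
      rw [h, Fin.univ_val_map]
      rfl
    rw [h1, Multiset.coe_sort]
    exact List.mergeSort_of_pairwise (by simpa using hpw.filter _)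
  rw [row, hs, getD_filter_ne_zero hpw]
  split_ifs with hj
  · rw [List.getD_eq_getElem _ _ (by simpa using hj), List.getElem_ofFn]
  · rw [List.getD_eq_default _ _ (by simpa using hj)]

theorem row_toPartition {n : ℕ} {lam : Fin n → ℕ} (h : Antitone lam) (j : ℕ) :
    row (toPartition lam) j = part lam (j + 1) := by
  rw [row_eq_of_parts_eq h rfl, part]
  split_ifs with h1 h2 h2
  · rfl
  · omega
  · omega
  · rfl

/-- The partitions of `N`, with the dominance ordering. -/
abbrev dominanceOrder (N : ℕ) : PartialOrder N.Partition where
  le := DominatedBy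
  le_refl μ _ := le_rfl
  le_trans _ _ _ h h' i := (h i).trans (h' i)
  le_antisymm μ ν h h' := row_injective <| funext fun j => by
    rw [dominatedBy_iff] at h h'
    have h1 := (h j).antisymm (h' j)
    have h2 := (h (j + 1)).antisymm (h' (j + 1))
    rw [Finset.sum_range_succ, Finset.sum_range_succ, h1] at h2
    exact Nat.add_left_cancel h2

/-- The exponent of the monomial with the rows of `μ` as exponents. -/
def rowExp (μ : N.Partition) : Fin N →₀ ℕ := Finsupp.equivFunOnFinite.symm fun j => row μ j

theorem rowExp_apply (μ : N.Partition) (j : Fin N) : rowExp μ j = row μ j := rfl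

theorem sum_le_sum_range {n : ℕ} {r : ℕ → ℕ} (hr : Antitone r) (S : Finset (Fin n)) :
    ∑ s ∈ S, r s ≤ ∑ j ∈ Finset.range S.card, r j := by
  -- The element number `k` of `S`, counted from zero, is at least `k`; a decreasing sequence is
  -- thus largest on an initial segment.
  have hle : ∀ k : Fin S.card, (k : ℕ) ≤ (S.orderEmbOfFin rfl k : Fin n) := by
    rintro ⟨k, hk⟩
    induction k with
    | zero => exact Nat.zero_le _
    | succ k ih =>
      have h1 := ih (Nat.lt_of_succ_lt hk)
      have h2 : S.orderEmbOfFin rfl ⟨k, Nat.lt_of_succ_lt hk⟩ < S.orderEmbOfFin rfl ⟨k + 1, hk⟩ :=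
        (S.orderEmbOfFin rfl).strictMono (by simp [Fin.lt_def])
      rw [Fin.lt_def] at h2
      exact Nat.succ_le_of_lt (lt_of_le_of_lt h1 h2)
  have h1 : ∑ s ∈ S, r s = ∑ k : Fin S.card, r (S.orderEmbOfFin rfl k : Fin n) := by
    conv_lhs => rw [← Finset.image_orderEmbOfFin_univ S rfl]
    rw [Finset.sum_image fun x _ y _ h => (S.orderEmbOfFin rfl).injective h]
  rw [h1, Finset.sum_range]
  exact Finset.sum_le_sum fun k _ => hr (hle k)

theorem dominatedBy_of_dominated {μ ν : N.Partition}
    (h : Dominated (fun j : Fin N => row μ j) (fun j : Fin N => row ν j)) : DominatedBy μ ν := by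
  rw [dominatedBy_iff]
  intro i
  rcases le_total N i with hi | hi
  · rw [sum_row μ hi, sum_row ν hi]
  · obtain ⟨T, hT, hle⟩ := h (Finset.univ.map (Fin.castLEEmb hi))
    rw [Finset.card_map, Finset.card_univ, Fintype.card_fin] at hT
    rw [Finset.sum_map] at hle
    rw [Finset.sum_range]
    refine hle.trans ((sum_le_sum_range (row_antitone ν) T).trans ?_)
    exact Finset.sum_le_sum_of_subset (Finset.range_subset_range.2 hT)

end

end JackRodrigues

end

noncomputable section

namespace JackRodrigues

open MvPolynomial

/-! Expansions in symmetric monomials -/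

section

/-- The multiset of the nonzero exponents. -/
def shape {σ : Type*} (a : σ →₀ ℕ) : Multiset ℕ := a.support.val.map a

theorem shape_eq_filter {σ : Type*} [Fintype σ] (a : σ →₀ ℕ) :
    shape a = (Finset.univ.val.map a).filter (· ≠ 0) := by
  classical
  have h : a.support = Finset.univ.filter fun s => a s ≠ 0 := by
    ext s
    simp
  rw [shape, Multiset.filter_map, h, Finset.filter_val]
  rfl

theorem sum_shape {σ : Type*} (a : σ →₀ ℕ) : (shape a).sum = a.degree := rfl

theorem shape_mapDomain {σ τ : Type*} {e : σ → τ} (he : Function.Injective e) (a : σ →₀ ℕ) :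
    shape (a.mapDomain e) = shape a := by
  classical
  rw [shape, Finsupp.mapDomain_support_of_injective he, Finset.image_val_of_injOn he.injOn,
    Multiset.map_map]
  exact Multiset.map_congr rfl fun s _ => Finsupp.mapDomain_apply he a s

/-- Equal shapes give equally many indices for each nonzero value, and then also for the value zero,
since the index set is the same. Bijections between the fibres combine to a permutation. -/
theorem exists_perm_of_shape_eq {σ : Type*} [Fintype σ] {a b : σ →₀ ℕ} (h : shape a = shape b) :
    ∃ e : Equiv.Perm σ, b.mapDomain e = a := by
  classical
  have hfib : ∀ c : ℕ, Nonempty ({s // a s = c} ≃ {s // b s = c}) := by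
    have key : ∀ c : ℕ, (Finset.univ.val.map a).count c = (Finset.univ.val.map b).count c := by
      have hne : ∀ c ≠ 0,
          (Finset.univ.val.map a).count c = (Finset.univ.val.map b).count c := by
        intro c hc
        rw [← Multiset.count_filter_of_pos (p := fun x : ℕ => x ≠ 0) hc, ← shape_eq_filter, h,
          shape_eq_filter, Multiset.count_filter_of_pos (p := fun x : ℕ => x ≠ 0) hc]
      intro c
      rcases eq_or_ne c 0 with rfl | hc
      · have h1 := congrArg Multiset.card (Multiset.filter_add_not (· ≠ 0) (Finset.univ.val.map a))
        have h2 := congrArg Multiset.card (Multiset.filter_add_not (· ≠ 0) (Finset.univ.val.map b))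
        rw [Multiset.card_add, ← shape_eq_filter, Multiset.card_map] at h1 h2
        rw [h] at h1
        simp only [not_not] at h1 h2
        rw [Multiset.count_eq_card_filter_eq, Multiset.count_eq_card_filter_eq]
        simp only [eq_comm (a := (0 : ℕ))]
        omega
      · exact hne c hc
    intro c
    have h1 := key c
    rw [Multiset.count_map, Multiset.count_map] at h1
    refine ⟨Fintype.equivOfCardEq ?_⟩
    rw [Fintype.card_subtype, Fintype.card_subtype, Finset.card_def, Finset.card_def,
      Finset.filter_val, Finset.filter_val]
    simpa only [eq_comm] using h1
  let g : σ ≃ σ := (Equiv.sigmaFiberEquiv a).symm.trans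
    ((Equiv.sigmaCongrRight fun c => (hfib c).some).trans (Equiv.sigmaFiberEquiv b))
  have hg : ∀ s, b (g s) = a s := fun s => ((hfib (a s)).some ⟨s, rfl⟩).2
  refine ⟨g.symm, Finsupp.ext fun s => ?_⟩
  rw [Finsupp.mapDomain_equiv_apply, Equiv.symm_symm, hg]

/-- Both exponents embed in `m + n` variables, where they differ by a permutation. Restriction along
any injection, a permutation included, carries `f(x_1, …, x_{m+n})` to `f` in the remaining
variables. -/
theorem coeff_toVars_of_shape_eq {K : Type*} [Field K] (f : SymFun K) {m n : ℕ} {a : Fin m →₀ ℕ}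
    {b : Fin n →₀ ℕ} (h : shape a = shape b) : coeff a (toVars m f) = coeff b (toVars n f) := by
  have hi : Function.Injective (Fin.castAdd n : Fin m → Fin (m + n)) := Fin.castAdd_injective m n
  have hj : Function.Injective (Fin.natAdd m : Fin n → Fin (m + n)) := Fin.natAdd_injective n m
  obtain ⟨e, he⟩ := exists_perm_of_shape_eq
    (((shape_mapDomain hi a).trans h).trans (shape_mapDomain hj b).symm)
  rw [← killCompl_toVars hi f, ← killCompl_toVars hj f, coeff_killCompl, coeff_killCompl, ← he,
    ← coeff_killCompl e.injective, killCompl_toVars]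

theorem coeff_msymm {σ R : Type*} [Fintype σ] [DecidableEq σ] [CommSemiring R] {N : ℕ}
    (μ : N.Partition) (a : σ →₀ ℕ) [Decidable (shape a = μ.parts)] :
    coeff a (msymm σ R μ) = if shape a = μ.parts then 1 else 0 := by
  have hprod : ∀ s : Multiset σ, (s.map (X : σ → MvPolynomial σ R)).prod =
      monomial (Multiset.toFinsupp s) 1 := by
    intro s
    induction s using Multiset.induction with
    | empty => simp
    | cons x s ih =>
      rw [Multiset.map_cons, Multiset.prod_cons, ih, X, monomial_mul, one_mul,
        ← Multiset.singleton_add, map_add, Multiset.toFinsupp_singleton]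
  have hshape : ∀ s : Sym σ N, (Nat.Partition.ofSym s).parts = shape (Multiset.toFinsupp s.1) :=
    fun s => rfl
  rw [msymm, coeff_sum]
  simp only [hprod, coeff_monomial]
  split_ifs with h
  · have hcard : (Finsupp.toMultiset a).card = N := by
      rw [Finsupp.card_toMultiset]
      have := sum_shape a
      rw [h, μ.parts_sum] at this
      exact this.symm
    have hs : Nat.Partition.ofSym (Sym.mk (Finsupp.toMultiset a) hcard) = μ := by
      apply Nat.Partition.ext
      refine (hshape _).trans (Eq.trans ?_ h)
      exact congrArg shape (Finsupp.toMultiset_toFinsupp a)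
    rw [Fintype.sum_eq_single ⟨_, hs⟩, if_pos (Finsupp.toMultiset_toFinsupp a)]
    intro s hne
    refine if_neg fun h1 => hne (Subtype.ext (Subtype.ext ?_))
    change s.1.1 = Finsupp.toMultiset a
    exact ((Multiset.toFinsupp_toMultiset _).symm.trans (congrArg Finsupp.toMultiset h1))
  · refine Finset.sum_eq_zero fun s _ => if_neg fun h1 => h ?_
    rw [← h1, ← hshape, s.2]

theorem shape_rowExp {N : ℕ} (μ : N.Partition) : shape (rowExp μ) = μ.parts := by
  have h1 := card_parts_le μ
  have h2 : List.ofFn (rowExp μ) = μ.parts.sort (· ≥ ·) ++ List.replicate (N - μ.parts.card) 0 := by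
    refine List.ext_getElem (by simp; omega) fun j hj hj' => ?_
    rw [List.getElem_ofFn, rowExp_apply, row, List.getElem_append]
    split_ifs with h
    · exact List.getD_eq_getElem _ _ h
    · rw [List.getElem_replicate, List.getD_eq_default _ _ (not_lt.1 h)]
  rw [shape_eq_filter, Fin.univ_val_map, h2, ← Multiset.coe_add, Multiset.filter_add,
    Multiset.sort_eq, Multiset.filter_eq_self.2 fun x hx => (μ.parts_pos hx).ne',
    Multiset.filter_eq_nil.2 fun x hx => by simpa using List.eq_of_mem_replicate hx, add_zero]

theorem toVars_monomial_isHomogeneous {K : Type*} [Field K] (n : ℕ) (m : ℕ+ →₀ ℕ) (c : K) :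
    (toVars n (monomial m c)).IsHomogeneous (size m) := by
  rw [toVars, aeval_monomial, size, Finsupp.weight_apply]
  rw [← zero_add (m.sum _)]
  refine (isHomogeneous_C (Fin n) c).mul (IsHomogeneous.prod _ _ _ fun k _ => ?_)
  change IsHomogeneous (psum (Fin n) K k ^ m k) (m k * k)
  rw [mul_comm]
  refine IsHomogeneous.pow (IsHomogeneous.sum _ _ _ fun j _ => ?_) _
  simpa using (isHomogeneous_X K j).pow (k : ℕ)

/-- A homogeneous symmetric function is the combination of symmetric monomials with the
coefficients of the monomials `x ^ μ`. -/
theorem toVars_eq_sum_msymm {K : Type*} [Field K] {N : ℕ} {f : SymFun K}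
    (hf : ∀ m, coeff m f ≠ 0 → size m = N) (n : ℕ) :
    toVars n f = ∑ μ : N.Partition, coeff (rowExp μ) (toVars N f) • msymm (Fin n) K μ := by
  classical
  ext a
  rw [coeff_sum]
  simp only [coeff_smul, coeff_msymm, smul_eq_mul, mul_ite, mul_one, mul_zero]
  by_cases ha : (shape a).sum = N
  · have hs : shape a = (Nat.Partition.mk (n := N) (shape a) (fun {x} hx => by
        rw [shape_eq_filter] at hx
        exact Nat.pos_of_ne_zero (Multiset.mem_filter.1 hx).2) ha).parts := rfl
    set μ : N.Partition := Nat.Partition.mk (n := N) (shape a) _ ha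
    rw [Fintype.sum_eq_single μ, if_pos hs]
    · exact coeff_toVars_of_shape_eq f (hs.trans (shape_rowExp μ).symm)
    · intro κ hκ
      exact if_neg fun h => hκ (Nat.Partition.ext (h.symm.trans hs))
  · rw [Finset.sum_eq_zero fun κ _ => if_neg fun h => ha (by rw [h, κ.parts_sum])]
    have hhom : (toVars n f).IsHomogeneous N := by
      rw [f.as_sum, map_sum]
      refine IsHomogeneous.sum _ _ _ fun m hm => ?_
      rw [← hf m (mem_support_iff.1 hm)]
      exact toVars_monomial_isHomogeneous n m _
    exact hhom.coeff_eq_zero fun h => ha (by rw [sum_shape, h])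

end

end JackRodrigues

end

noncomputable section

namespace JackRodrigues

open MvPolynomial

/-! The family of Jack functions -/

section

variable {N : ℕ}

/-- The number of columns of length `k ≥ 1`. -/
def columnCount (μ : N.Partition) (k : ℕ) : ℕ := row μ (k - 1) - row μ k

theorem columnParts_columnCount (μ : N.Partition) (j : Fin N) :
    columnParts (columnCount μ) N j = row μ j := by
  -- The column counts are differences of successive rows, so the sum telescopes.
  have h : ∀ i, (j : ℕ) ≤ i →
      (∑ k ∈ Finset.Ico (j : ℕ) i, columnCount μ (k + 1)) + row μ i = row μ j := by
    intro i hi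
    induction i, hi using Nat.le_induction with
    | base => simp
    | succ i hi ih =>
      rw [Finset.sum_Ico_succ_top hi, ← ih, columnCount, Nat.add_sub_cancel]
      have := row_antitone μ (Nat.le_succ i)
      simp only [Nat.succ_eq_add_one] at this
      omega
  have h1 := h N j.2.le
  rwa [row_eq_zero μ le_rfl, add_zero] at h1

theorem columnSize_columnCount (μ : N.Partition) : columnSize (columnCount μ) N = N := by
  -- Summation by parts: the boxes in columns of length at most `i`, plus `i` rows of length `row μ
  -- i`, fill the first `i` rows.
  have h : ∀ i, columnSize (columnCount μ) i + i * row μ i = ∑ j ∈ Finset.range i, row μ j := by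
    intro i
    induction i with
    | zero => simp [columnSize]
    | succ i ih =>
      rw [Finset.sum_range_succ, ← ih, columnSize, columnSize, Finset.sum_range_succ, columnCount,
        Nat.add_sub_cancel]
      have := row_antitone μ (Nat.le_succ i)
      obtain ⟨c, hc⟩ := Nat.exists_eq_add_of_le this
      rw [hc, Nat.succ_eq_add_one, Nat.add_sub_cancel_left]
      ring
  have h1 := h N
  rwa [row_eq_zero μ le_rfl, mul_zero, add_zero, sum_row μ le_rfl] at h1

theorem toVars_jackFun_eq_of_le {K : Type*} [Field K] [CharZero K] {α : K} (hα : α ≠ 0)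
    {d : ℕ → ℕ} (n : ℕ) {i j : ℕ} (hij : i ≤ j) (hd : ∀ k, i < k → d k = 0) :
    toVars n (jackFun α d j) = toVars n (jackFun α d i) := by
  induction j, hij using Nat.le_induction with
  | base => rfl
  | succ j hj ih =>
    rw [toVars_jackFun_succ hα, hd _ (Nat.lt_succ_of_le hj), pow_zero, Module.End.one_apply, ih]

theorem toVars_jackFun_toPartition {K : Type*} [Field K] [CharZero K] {α : K} (hα : α ≠ 0) {n : ℕ}
    {lam : Fin n → ℕ} (h : Antitone lam) :
    toVars n (jackFun α (columnCount (toPartition lam)) (∑ i, lam i)) = rodrigues α lam := by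
  have hrow := row_toPartition h
  have hcount : ∀ k, 1 ≤ k →
      columnCount (toPartition lam) k = part lam k - part lam (k + 1) := by
    intro k hk
    rw [columnCount, hrow, hrow, Nat.sub_add_cancel hk]
  have h1 : toVars n (jackFun α (columnCount (toPartition lam)) (∑ i, lam i)) =
      toVars n (jackFun α (columnCount (toPartition lam)) n) := by
    -- The Jack function uses column lengths up to `∑ lam`, the Rodrigues product up to `n`. The
    -- excess exponents are zero, as no column is longer than the size of the partition or than the
    -- number of rows.
    rcases le_total (∑ i, lam i) n with hle | hle
    · refine (toVars_jackFun_eq_of_le hα n hle fun k hk => ?_).symm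
      rw [columnCount, row_eq_zero _ (Nat.le_sub_one_of_lt hk), Nat.zero_sub]
    · refine toVars_jackFun_eq_of_le hα n hle fun k hk => ?_
      rw [hcount k (by omega), part, dif_neg (by omega), Nat.zero_sub]
  rw [h1, toVars_jackFun hα, rodrigues]
  congr 3
  funext k
  rw [hcount _ (by omega)]

theorem parts_onesPartition (N : ℕ) : (onesPartition N).parts = Multiset.replicate N 1 := by
  simp only [onesPartition, Nat.Partition.ofSums_parts]
  exact Multiset.filter_eq_self.2 fun x hx => by simp [Multiset.eq_of_mem_replicate hx]

theorem shape_indicatorExp {n : ℕ} (S : Finset (Fin n)) :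
    shape (indicatorExp S) = Multiset.replicate S.card 1 := by
  classical
  have h : (indicatorExp S).support = S := by
    ext s
    simp [indicatorExp_apply]
  rw [shape, h, Multiset.eq_replicate]
  refine ⟨by simp, fun x hx => ?_⟩
  obtain ⟨s, hs, rfl⟩ := Multiset.mem_map.1 hx
  exact (indicatorExp_apply S s).trans (if_pos hs)

theorem isJackFamily_jackFun {K : Type*} [Field K] [CharZero K] {α : K} (hα : α ≠ 0) :
    IsJackFamily α fun N (μ : N.Partition) => jackFun α (columnCount μ) N where
  orthogonal M N μ ν hne := by
    by_contra h0
    rcases eq_or_ne M N with rfl | hMN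
    · have h1 := dominated_of_scalarProduct_jackFun hα _ _ _ _ h0
      -- Symmetry of the scalar product yields the opposite dominance, and antisymmetry identifies
      -- the partitions.
      rw [scalarProduct_comm] at h0
      have h2 := dominated_of_scalarProduct_jackFun hα _ _ _ _ h0
      rw [funext (columnParts_columnCount μ), funext (columnParts_columnCount ν)] at h1 h2
      refine hne (congrArg _ ((dominanceOrder M).le_antisymm _ _ ?_ ?_))
      · exact dominatedBy_of_dominated h1
      · exact dominatedBy_of_dominated h2
    · refine h0 (scalarProduct_jackFun_of_ne _ _ _ _ _ ?_)
      rwa [columnSize_columnCount, columnSize_columnCount]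
  triangular N ν := by
    refine ⟨fun μ => coeff (rowExp μ) (toVars N (jackFun α (columnCount ν) N)), ?_, ?_, ?_⟩
    · intro μ hμ
      by_contra h0
      have h1 := dominated_of_coeff_jackFun hα _ _ _ _ h0
      rw [funext (columnParts_columnCount ν)] at h1
      exact hμ (dominatedBy_of_dominated h1)
    · exact toVars_eq_sum_msymm fun m hm =>
        (size_of_coeff_jackFun hm).trans (columnSize_columnCount ν)
    · have h1 : shape (rowExp (onesPartition N)) =
          shape (indicatorExp (Finset.univ : Finset (Fin N))) := by
        rw [shape_rowExp, parts_onesPartition, shape_indicatorExp, Finset.card_univ,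
          Fintype.card_fin]
      have h2 := coeff_indicatorExp_jackFun hα (columnCount ν) N N Finset.univ
        (by rw [columnSize_columnCount, Finset.card_univ, Fintype.card_fin])
      rw [columnSize_columnCount] at h2
      exact (coeff_toVars_of_shape_eq _ h1).trans h2

/-- The graph of the expansion in symmetric monomials. -/
def expansionGraph (K : Type*) [Field K] (N : ℕ) :
    Submodule K (SymFun K × (N.Partition → K)) where
  carrier := {p | ∀ n, toVars n p.1 = ∑ μ, p.2 μ • msymm (Fin n) K μ}
  add_mem' {p q} hp hq n := by
    simp only [Prod.fst_add, Prod.snd_add, map_add, Pi.add_apply, add_smul,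
      Finset.sum_add_distrib, hp n, hq n]
  zero_mem' n := by simp
  smul_mem' c p hp n := by
    simp only [Prod.smul_fst, Prod.smul_snd, map_smul, Pi.smul_apply, smul_assoc,
      ← Finset.smul_sum, hp n]

theorem IsJackFamily.isTriangular {K : Type*} [Field K] {α : K}
    {Jack : (N : ℕ) → N.Partition → SymFun K} (h : IsJackFamily α Jack) (N : ℕ) :
    letI := dominanceOrder N
    ∃ v, IsTriangular (scalarForm α) (expansionGraph K N) (onesPartition N) (N.factorial : K)
      (Jack N) v := by
  let := dominanceOrder N
  choose v hv using h.triangular N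
  refine ⟨v, fun μ ν hne => ?_, fun ν => (hv ν).2.1, fun ν μ h0 => ?_, fun ν => (hv ν).2.2⟩
  · refine h.orthogonal N N μ ν fun e => hne ?_
    simpa using e
  · by_contra hle
    exact h0 ((hv ν).1 μ hle)

theorem IsJackFamily.unique {Jack Jack' : (N : ℕ) → N.Partition → SymFun (RatFunc ℚ)}
    (h : IsJackFamily (RatFunc.X : RatFunc ℚ) Jack)
    (h' : IsJackFamily (RatFunc.X : RatFunc ℚ) Jack') : Jack = Jack' := by
  classical
  funext N
  let := dominanceOrder N
  obtain ⟨v, hv⟩ := h.isTriangular N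
  obtain ⟨v', hv'⟩ := h'.isTriangular N
  refine hv.unique hv' (fun f hf => ?_) (fun w hw => ?_)
    (fun f hf => eq_zero_of_scalarProduct_self hf) (by exact_mod_cast N.factorial_ne_zero)
  · refine eq_zero_of_toVars fun n => (hf n).trans ?_
    simp
  -- In `N` variables the coefficient of `x_1 ⋯ x_N` isolates the coordinate at `1^N`.
  · have h1 := congrArg (coeff (rowExp (onesPartition N))) (hw N)
    simp only [map_zero, coeff_zero, coeff_sum, coeff_smul, coeff_msymm, shape_rowExp] at h1
    rw [Fintype.sum_eq_single (onesPartition N) fun μ hμ => by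
      rw [if_neg fun e => hμ (Nat.Partition.ext e.symm), smul_zero]] at h1
    simpa using h1.symm

end

end JackRodrigues

end

/-! ### The Rodrigues formula for the Jack symmetric functions -/

theorem theorem1 :
    (∃! Jack : (N : ℕ) → N.Partition → JackRodrigues.SymFun (RatFunc ℚ),
      JackRodrigues.IsJackFamily (RatFunc.X : RatFunc ℚ) Jack) ∧
    ∀ Jack : (N : ℕ) → N.Partition → JackRodrigues.SymFun (RatFunc ℚ),
      JackRodrigues.IsJackFamily (RatFunc.X : RatFunc ℚ) Jack →
      ∀ (n : ℕ) (lam : Fin n → ℕ), Antitone lam →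
        JackRodrigues.toVars n (Jack (∑ i, lam i) (JackRodrigues.toPartition lam)) =
          JackRodrigues.rodrigues (RatFunc.X : RatFunc ℚ) lam := by
  have h := JackRodrigues.isJackFamily_jackFun (RatFunc.X_ne_zero (K := ℚ))
  refine ⟨⟨_, h, fun Jack hJack => hJack.unique h⟩, fun Jack hJack n lam hlam => ?_⟩
  rw [hJack.unique h]
  exact JackRodrigues.toVars_jackFun_toPartition RatFunc.X_ne_zero hlam
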